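/- Consider a slotted two-hop status-update system with a source, a relay and a destination. The source-relay and relay-destination links succeed in a slot with probabilities $p$ and $q$, where $0<p<1$ and $0<q<1$. The state is $(k,d)$, where $k$ is the age of information at the relay and $d$ is the age gain, so that $k+d$ is the age at the destination. The state space is $\mathcal V=\{(k,d)\in\mathbb N^2:\ (k\ge 2,\ d=0)\ \text{or}\ (k\ge 1,\ d\ge 2)\}$. In each slot the relay chooses an action $w\in\{0,1\}$. If it receives ($w=0$), the next state is $(1,k+d)$ with probability $p$ and $(k+1,d)$ with probability $1-p$. If it forwards ($w=1$), the next state is $(k+1,0)$ with probability $q$ and $(k+1,d)$ with probability $1-q$. A stationary deterministic policy is a map $\theta:\mathcal V\to\{0,1\}$. Write $(k_t,d_t)$ and $w_t$ for the state and the action in slot $t$ under $\theta$. For a multiplier $\lambda\ge 0$ and an initial state $s_0\in\mathcal V$, the average Lagrangian cost of $\theta$ is $$L_\lambda(\theta)=\limsup_{T\to\infty}\frac1T\Big(\mathbb E\Big[\sum_{t=1}^T (k_t+d_t)\Big]+\lambda\,\mathbb E\Big[\sum_{t=1}^T w_t\Big]\Big)\in[0,\infty].$$ **Theorem.** Let $\lambda\ge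 0$, let $s_0\in\mathcal V$, and let $\theta$ be a stationary deterministic policy that minimizes $L_\lambda$ among all stationary deterministic policies. (In particular, $\theta$ may be either of the policies $\theta_{\lambda^*}$, $\lambda^*\in\{\lambda_1^*,\lambda_2^*\}$, of which the optimal policy $\theta_{\rm CMDP}$ of the problem with constrained average number of forwarding actions is a randomized mixture.) Then $\theta$ is of switching type. That is, for all $z\in\mathbb N$ and all states in $\mathcal V$: 1. if $\theta(k,d)=1$ and $(k,d+z)\in\mathcal V$, then $\theta(k,d+z)=1$; 2. if $\theta(k,d)=0$, then $\theta(k+z,d)=0$. Hence $\theta$ is nondecreasing in $d$ for fixed $k$ and nonincreasing in $k$ for fixed $d$. It has a multi-threshold structure: there are functions $\tau,\kappa:\mathbb N\to\mathbb N\cup\{\infty\}$ such that, for every $(k,d)\in\mathcal V$, $\theta(k,d)=1$ if and only if $d\ge\tau(k)$, and also if and only if $k\le\kappa(d)$. -/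

import Mathlib

open scoped ENNReal NNReal

namespace RelayAoI

/-- `(k, d)` is an admissible pair (relay age, age gain): `k ≥ 2, d = 0` or `k ≥ 1, d ≥ 2`. -/
def Admissible (k d : ℕ) : Prop :=
  (2 ≤ k ∧ d = 0) ∨ (1 ≤ k ∧ 2 ≤ d)

/-- The state space: `k` is the age at the relay, `d` the age gain, so that `k + d` is the age at
the destination. -/
@[ext]
structure State where
  k : ℕ
  d : ℕ
  admissible : Admissible k d

/-- The actions: `0` is receiving from the source, `1` is forwarding to the destination. -/
abbrev Action : Type := Fin 2

/-- Stationary deterministic policies. -/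
abbrev Policy : Type := State → Action

/-- The age at the relay in the next slot; `iSR` tells whether the source-relay link works. -/
def nextAge (v : State) (w : Action) (iSR : Bool) : ℕ :=
  if w = 0 ∧ iSR = true then 1 else v.k + 1

/-- The age gain in the next slot; `iSR` and `iRD` tell whether the source-relay link and the
relay-destination link work. -/
def nextGain (v : State) (w : Action) (iSR iRD : Bool) : ℕ :=
  if w = 1 ∧ iRD = true then 0
  else if w = 0 ∧ iSR = true then v.k + v.d
  else v.d

theorem admissible_next (v : State) (w : Action) (iSR iRD : Bool) :
    Admissible (nextAge v w iSR) (nextGain v w iSR iRD) := by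
  have h := v.admissible
  unfold Admissible at *
  fin_cases w <;> cases iSR <;> cases iRD <;> simp [nextAge, nextGain] <;> omega

/-- The evolution of the system in one slot. -/
def nextState (v : State) (w : Action) (iSR iRD : Bool) : State :=
  ⟨nextAge v w iSR, nextGain v w iSR iRD, admissible_next v w iSR iRD⟩

/-- The law of the success indicator of a link with success probability `p`. -/
noncomputable def linkLaw (p : unitInterval) : PMF Bool :=
  PMF.ofFintype
    (fun b => if b = true then ENNReal.ofReal (p : ℝ) else ENNReal.ofReal (1 - (p : ℝ))) (by
      have h0 : (0 : ℝ) ≤ (p : ℝ) := p.2.1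
      have h1 : (0 : ℝ) ≤ 1 - (p : ℝ) := sub_nonneg.2 p.2.2
      simp [← ENNReal.ofReal_add h0 h1])

/-- The transition law out of state `v` under action `w`, where `p` and `q` are the success
probabilities of the source-relay and the relay-destination link. -/
noncomputable def transition (p q : unitInterval) (v : State) (w : Action) : PMF State :=
  (linkLaw p).bind fun iSR => (linkLaw q).map fun iRD => nextState v w iSR iRD

/-- The law of the state after `t` slots under the policy `θ`, started in `s₀`. -/
noncomputable def stateLaw (p q : unitInterval) (θ : Policy) (s₀ : State) : ℕ → PMF State
  | 0 => PMF.pure s₀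
  | t + 1 => (stateLaw p q θ s₀ t).bind fun v => transition p q v (θ v)

/-- The expectation of a nonnegative function of a random state (possibly `∞`). -/
noncomputable def expect (μ : PMF State) (f : State → ℝ≥0∞) : ℝ≥0∞ :=
  ∑' v, μ v * f v

/-- The expected sum of the ages at the destination over the first `T` slots. -/
noncomputable def totalAge (p q : unitInterval) (θ : Policy) (s₀ : State) (T : ℕ) : ℝ≥0∞ :=
  ∑ t ∈ Finset.range T, expect (stateLaw p q θ s₀ t) fun v => (v.k : ℝ≥0∞) + (v.d : ℝ≥0∞)

/-- The expected number of forwarding actions in the first `T` slots. -/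
noncomputable def totalForward (p q : unitInterval) (θ : Policy) (s₀ : State) (T : ℕ) : ℝ≥0∞ :=
  ∑ t ∈ Finset.range T, expect (stateLaw p q θ s₀ t) fun v => (((θ v).val : ℕ) : ℝ≥0∞)

/-- The long-run average Lagrangian cost of `θ` for the multiplier `lam`, started in `s₀`. -/
noncomputable def lagrangianCost (p q : unitInterval) (lam : ℝ≥0) (s₀ : State) (θ : Policy) :
    ℝ≥0∞ :=
  Filter.limsup (fun T : ℕ =>
    (totalAge p q θ s₀ T + (lam : ℝ≥0∞) * totalForward p q θ s₀ T) / (T : ℝ≥0∞)) Filter.atTop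

/-- `θ` minimizes the average Lagrangian cost over all stationary deterministic policies. -/
def IsLagrangianOptimal (p q : unitInterval) (lam : ℝ≥0) (s₀ : State) (θ : Policy) : Prop :=
  ∀ θ' : Policy, lagrangianCost p q lam s₀ θ ≤ lagrangianCost p q lam s₀ θ'

/-- Switching type: forwarding at `(k, d)` entails forwarding at every state `(k, d + z)`, and
receiving at `(k, d)` entails receiving at every state `(k + z, d)`. -/
def IsSwitchingType (θ : Policy) : Prop :=
  (∀ (k d z : ℕ) (h : Admissible k d) (h' : Admissible k (d + z)),
    θ ⟨k, d, h⟩ = 1 → θ ⟨k, d + z, h'⟩ = 1) ∧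
  (∀ (k d z : ℕ) (h : Admissible k d) (h' : Admissible (k + z) d),
    θ ⟨k, d, h⟩ = 0 → θ ⟨k + z, d, h'⟩ = 0)

/-- For fixed relay age the policy is nondecreasing in the age gain, and for fixed age gain it is
nonincreasing in the relay age. -/
def IsMonotonePolicy (θ : Policy) : Prop :=
  (∀ v v' : State, v.k = v'.k → v.d ≤ v'.d → θ v ≤ θ v') ∧
  (∀ v v' : State, v.d = v'.d → v.k ≤ v'.k → θ v' ≤ θ v)

/-- Multi-threshold structure: for each relay age `k` the policy forwards exactly when the age gain
is at least a threshold `τ k`, and for each age gain `d` it forwards exactly when the relay age is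
at most a threshold `κ d` (thresholds may be `∞`). -/
def IsMultiThreshold (θ : Policy) : Prop :=
  (∃ τ : ℕ → ℕ∞, ∀ v : State, θ v = 1 ↔ τ v.k ≤ (v.d : ℕ∞)) ∧
  (∃ κ : ℕ → ℕ∞, ∀ v : State, θ v = 1 ↔ (v.k : ℕ∞) ≤ κ v.d)

end RelayAoI

namespace RelayAoI

open Filter Topology

/-! Everything rests on a solution `h`, `g` of the average cost optimality equation `bellman P 1 h =
h + g` and on the sign of its `advantage` A(k,d), the receiving branch minus the forwarding branch.
Two facts give the theorem: A is strictly increasing in d, and nonincreasing in k with strict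
decrease wherever it is still nonnegative; and an optimal policy agrees with the sign of A at every
state. Strictness makes the tie-breaking at A = 0 harmless, so every optimal policy is covered, not
just one well-chosen version.

For the first fact, six inequalities (`Structured`) are preserved together by the dynamic
programming operator, hence hold along value iteration from zero, for the discounted values, and in
the vanishing-discount limit (`exists_average_solution`). The limit exists because a linear
supersolution bounds (1-α)V and because the increments of V are bounded uniformly in α. Strictness
comes from the unit growth of the stage cost (`bellman_gain`, `bellman_age_of_forward`).

For the second fact, telescoping the optimality equation shows that the cost of a policy exceeds g
per slot by its mean `loss`, up to the terminal term E h, which is o(T) because h grows linearly and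
a policy of finite cost has mean age o(T). So an optimal policy has no loss at a state of
non-vanishing frequency (`loss_eq_zero_of_frequent`). Finally all states are such
(`frequent_of_optimal`): ageing under link failures leads to states where the strict sign of A
forces the action, and these forced moves reach the whole state space. This is why optimality from
the single initial state `s₀` determines the structure everywhere. -/

/-- The data of the two-hop system for the optimality equations. -/
structure Params where
  p : ℝ
  q : ℝ
  lam : ℝ
  p_pos : 0 < p
  p_lt : p < 1
  q_pos : 0 < q
  q_lt : q < 1
  lam_nonneg : 0 ≤ lam

variable {P : Params}

/-! ### Structural inequalities preserved by the dynamic programming operator -/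

/-- Discounted expected continuation cost of receiving. -/
def receiveCost (P : Params) (α : ℝ) (V : ℕ → ℕ → ℝ) (k d : ℕ) : ℝ :=
  α * (P.p * V 1 (k + d) + (1 - P.p) * V (k + 1) d)

/-- Cost of forwarding plus the discounted expected continuation cost. -/
def forwardCost (P : Params) (α : ℝ) (V : ℕ → ℕ → ℝ) (k d : ℕ) : ℝ :=
  P.lam + α * (P.q * V (k + 1) 0 + (1 - P.q) * V (k + 1) d)

/-- The dynamic programming operator, on all pairs of natural numbers. -/
noncomputable def bellman (P : Params) (α : ℝ) (V : ℕ → ℕ → ℝ) (k d : ℕ) : ℝ :=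
  k + d + min (receiveCost P α V k d) (forwardCost P α V k d)

/-- The advantage of forwarding over receiving. -/
def advantage (P : Params) (α : ℝ) (V : ℕ → ℕ → ℝ) (k d : ℕ) : ℝ :=
  receiveCost P α V k d - forwardCost P α V k d

/-- The structural properties of value functions that the dynamic programming operator preserves. -/
structure Structured (P : Params) (V : ℕ → ℕ → ℝ) : Prop where
  mono : ∀ k d, V k d ≤ V k (d + 1)
  shift : ∀ k d, V k (d + 1) ≤ V (k + 1) d
  concave : ∀ k d, V k (d + 2) - V k (d + 1) ≤ V k (d + 1) - V k d
  gain : ∀ k d, 0 ≤ P.p * (V 1 (k + d + 1) - V 1 (k + d)) +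
    (P.q - P.p) * (V (k + 1) (d + 1) - V (k + 1) d)
  super : ∀ k d, V k (d + 2) - V k (d + 1) ≤ V (k + 1) (d + 1) - V (k + 1) d
  age : ∀ k d, P.p * (V k (d + 1) - V k d) + (P.q - P.p) * (V (k + 1) d - V k d) ≤
    P.q * (V (k + 1) 0 - V k 0)

/-- The increment of a minimum lies between the increments of its two branches. With the
monotonicity of the advantage this gives two-sided bounds on increments of `bellman` without knowing
which action is optimal. -/
theorem min_sub_min_bounds {a b a' b' : ℝ} (h : b' - b ≤ a' - a) :
    b' - b ≤ min a' b' - min a b ∧ min a' b' - min a b ≤ a' - a := by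
  rcases le_total a b with h1 | h1 <;> rcases le_total a' b' with h2 | h2 <;>
    simp only [min_eq_left, min_eq_right, h1, h2] <;> constructor <;> linarith

/-- The bracket is exactly the quantity in `Structured.gain`, which is therefore the statement that
the advantage grows with d. -/
theorem advantage_succ_sub (V : ℕ → ℕ → ℝ) (α : ℝ) (k d : ℕ) :
    advantage P α V k (d + 1) - advantage P α V k d =
      α * (P.p * (V 1 (k + d + 1) - V 1 (k + d)) +
        (P.q - P.p) * (V (k + 1) (d + 1) - V (k + 1) d)) := by
  simp only [advantage, receiveCost, forwardCost, ← add_assoc]; ring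

namespace Structured

variable {V : ℕ → ℕ → ℝ} (hV : Structured P V)
include hV

theorem mono_k (k d : ℕ) : V k d ≤ V (k + 1) d := (hV.mono k d).trans (hV.shift k d)

theorem le_of_le {k k' d d' : ℕ} (hk : k ≤ k') (hd : d ≤ d') : V k d ≤ V k' d' :=
  (monotone_nat_of_le_succ (fun k => hV.mono_k k d) hk).trans
    (monotone_nat_of_le_succ (hV.mono k') hd)

theorem shift_add (k d j : ℕ) : V k (d + j) ≤ V (k + j) d := by
  induction j generalizing d with
  | zero => simp
  | succ j ih =>
    have := ih (d + 1)
    rw [show d + (j + 1) = d + 1 + j by ring]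
    exact this.trans (hV.shift _ _)

theorem fresh_le (k : ℕ) : V 1 k ≤ V (k + 1) 0 := by
  have := hV.shift_add 1 0 k
  rwa [zero_add, add_comm 1 k] at this

theorem concave_add (k d j : ℕ) :
    V k (d + j + 1) - V k (d + j) ≤ V k (d + 1) - V k d := by
  induction j with
  | zero => simp
  | succ j ih => exact (hV.concave k (d + j)).trans ih

theorem super_fresh (k d : ℕ) :
    V 1 (k + d + 1) - V 1 (k + d) ≤ V (k + 1) (d + 1) - V (k + 1) d := by
  induction k generalizing d with
  | zero => simp
  | succ k ih =>
    have := ih (d + 1)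
    rw [show k + 1 + d = k + (d + 1) by ring]
    exact this.trans (hV.super _ _)

/-- The increment of V at relay age 1 is replaced, via `super_fresh`, by one at relay age k + 1.
What remains is `Structured.age` at k + 1, so that field is what makes the advantage nonincreasing
in k. -/
theorem advantage_age (α : ℝ) (hα : 0 ≤ α) (k d : ℕ) :
    advantage P α V (k + 1) d - advantage P α V k d ≤
      α * (P.p * (V (k + 1) (d + 1) - V (k + 1) d) + (P.q - P.p) * (V (k + 2) d - V (k + 1) d) -
        P.q * (V (k + 2) 0 - V (k + 1) 0)) := by
  have h := mul_le_mul_of_nonneg_left (hV.super_fresh k d) (mul_nonneg hα P.p_pos.le)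
  simp only [advantage, receiveCost, forwardCost, show k + 1 + d = k + d + 1 by ring,
    show k + 1 + 1 = k + 2 by ring]
  linarith

variable {α : ℝ} (h0 : 0 ≤ α)
include h0

theorem advantage_mono_d (k d : ℕ) : advantage P α V k d ≤ advantage P α V k (d + 1) := by
  have := advantage_succ_sub (P := P) V α k d
  have := mul_nonneg h0 (hV.gain k d)
  linarith

theorem advantage_anti_k (k d : ℕ) : advantage P α V (k + 1) d ≤ advantage P α V k d := by
  have := hV.advantage_age α h0 k d
  have h2 := mul_le_mul_of_nonneg_left (hV.age (k + 1) d) h0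
  simp only [show k + 1 + 1 = k + 2 by ring] at h2
  linarith

theorem receive_le_forward_zero (k : ℕ) : receiveCost P α V k 0 ≤ forwardCost P α V k 0 := by
  have := mul_le_mul_of_nonneg_left (hV.fresh_le k) (mul_nonneg h0 P.p_pos.le)
  have := P.lam_nonneg
  simp only [receiveCost, forwardCost, add_zero]
  linarith

theorem bellman_zero (k : ℕ) :
    bellman P α V k 0 = k + α * (P.p * V 1 k + (1 - P.p) * V (k + 1) 0) := by
  rw [bellman, min_eq_left (hV.receive_le_forward_zero h0 k)]
  simp [receiveCost]

theorem bellman_age_zero (k : ℕ) :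
    bellman P α V (k + 1) 0 - bellman P α V k 0 =
      1 + α * (P.p * (V 1 (k + 1) - V 1 k) + (1 - P.p) * (V (k + 2) 0 - V (k + 1) 0)) := by
  rw [hV.bellman_zero h0, hV.bellman_zero h0]; push_cast; ring

theorem bellman_d_bounds (k d : ℕ) :
    1 + α * ((1 - P.q) * (V (k + 1) (d + 1) - V (k + 1) d)) ≤
      bellman P α V k (d + 1) - bellman P α V k d ∧
    bellman P α V k (d + 1) - bellman P α V k d ≤
      1 + α * (P.p * (V 1 (k + d + 1) - V 1 (k + d)) +
        (1 - P.p) * (V (k + 1) (d + 1) - V (k + 1) d)) := by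
  have h := hV.advantage_mono_d h0 k d
  have hb := min_sub_min_bounds (a := receiveCost P α V k d) (b := forwardCost P α V k d)
    (a' := receiveCost P α V k (d + 1)) (b' := forwardCost P α V k (d + 1))
    (by unfold advantage at h; linarith)
  obtain ⟨h1, h2⟩ := hb
  unfold bellman
  push_cast
  constructor
  · refine le_trans (le_of_eq ?_) (add_le_add_right h1 1) |>.trans (le_of_eq (by ring))
    simp only [forwardCost]; ring
  · refine (le_of_eq (by ring)).trans ((add_le_add_right h2 1).trans (le_of_eq ?_))
    simp only [receiveCost, ← add_assoc]; ring

theorem bellman_d_forward {k d : ℕ} (h : 0 ≤ advantage P α V k d) :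
    bellman P α V k (d + 1) - bellman P α V k d =
      1 + α * ((1 - P.q) * (V (k + 1) (d + 1) - V (k + 1) d)) := by
  have h' := h.trans (hV.advantage_mono_d h0 k d)
  unfold advantage at h h'
  rw [bellman, bellman, min_eq_right (by linarith), min_eq_right (by linarith)]
  simp only [forwardCost]; push_cast; ring

theorem bellman_d_receive {k d : ℕ} (h : advantage P α V k (d + 1) ≤ 0) :
    bellman P α V k (d + 1) - bellman P α V k d =
      1 + α * (P.p * (V 1 (k + d + 1) - V 1 (k + d)) +
        (1 - P.p) * (V (k + 1) (d + 1) - V (k + 1) d)) := by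
  have h' := (hV.advantage_mono_d h0 k d).trans h
  unfold advantage at h h'
  rw [bellman, bellman, min_eq_left (by linarith), min_eq_left (by linarith)]
  simp only [receiveCost, ← add_assoc]; push_cast; ring

theorem bellman_k_bounds (k d : ℕ) :
    1 + α * (P.p * (V 1 (k + d + 1) - V 1 (k + d)) + (1 - P.p) * (V (k + 2) d - V (k + 1) d)) ≤
      bellman P α V (k + 1) d - bellman P α V k d ∧
    bellman P α V (k + 1) d - bellman P α V k d ≤
      1 + α * (P.q * (V (k + 2) 0 - V (k + 1) 0) + (1 - P.q) * (V (k + 2) d - V (k + 1) d)) := by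
  have h := hV.advantage_anti_k h0 k d
  have hb := min_sub_min_bounds (b := receiveCost P α V k d) (a := forwardCost P α V k d)
    (b' := receiveCost P α V (k + 1) d) (a' := forwardCost P α V (k + 1) d)
    (by unfold advantage at h; linarith)
  obtain ⟨h1, h2⟩ := hb
  unfold bellman
  rw [min_comm, min_comm (receiveCost P α V k d)]
  push_cast
  constructor
  · refine le_trans (le_of_eq ?_) (add_le_add_right h1 1) |>.trans (le_of_eq (by ring))
    simp only [receiveCost, show k + 1 + d = k + d + 1 by ring, show k + 1 + 1 = k + 2 by ring]
    ring
  · refine (le_of_eq (by ring)).trans ((add_le_add_right h2 1).trans (le_of_eq ?_))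
    simp only [forwardCost, show k + 1 + 1 = k + 2 by ring]; ring

theorem bellman_k_receive {k d : ℕ} (h : advantage P α V k d ≤ 0) :
    bellman P α V (k + 1) d - bellman P α V k d =
      1 + α * (P.p * (V 1 (k + d + 1) - V 1 (k + d)) +
        (1 - P.p) * (V (k + 2) d - V (k + 1) d)) := by
  have h' := (hV.advantage_anti_k h0 k d).trans h
  unfold advantage at h h'
  rw [bellman, bellman, min_eq_left (by linarith), min_eq_left (by linarith)]
  simp only [receiveCost, show k + 1 + d = k + d + 1 by ring, show k + 1 + 1 = k + 2 by ring]
  push_cast; ring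

theorem one_le_bellman_d (k d : ℕ) : 1 ≤ bellman P α V k (d + 1) - bellman P α V k d := by
  have := (hV.bellman_d_bounds h0 k d).1
  have := mul_nonneg h0 (mul_nonneg (sub_nonneg.2 P.q_lt.le) (sub_nonneg.2 (hV.mono (k + 1) d)))
  linarith

theorem bellman_shift (k d : ℕ) : bellman P α V k (d + 1) ≤ bellman P α V (k + 1) d := by
  have hp := P.p_lt
  have hq := P.q_lt
  have hp0 := P.p_pos
  have hq0 := P.q_pos
  unfold bellman
  push_cast
  have : min (receiveCost P α V k (d + 1)) (forwardCost P α V k (d + 1)) ≤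
      min (receiveCost P α V (k + 1) d) (forwardCost P α V (k + 1) d) := by
    apply min_le_min
    · unfold receiveCost
      rw [show k + 1 + d = k + (d + 1) by ring]
      have := hV.shift (k + 1) d
      gcongr
    · unfold forwardCost
      have := hV.shift (k + 1) d
      have := hV.mono_k (k + 1) 0
      gcongr
  linarith

theorem bellman_concave (k d : ℕ) :
    bellman P α V k (d + 2) - bellman P α V k (d + 1) ≤
      bellman P α V k (d + 1) - bellman P α V k d := by
  have hp : 0 ≤ α * (1 - P.p) := mul_nonneg h0 (sub_nonneg.2 P.p_lt.le)
  have hq : 0 ≤ α * (1 - P.q) := mul_nonneg h0 (sub_nonneg.2 P.q_lt.le)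
  have hp0 := mul_nonneg h0 P.p_pos.le
  have e1 := mul_le_mul_of_nonneg_left (hV.concave 1 (k + d)) hp0
  have e2 := mul_le_mul_of_nonneg_left (hV.concave (k + 1) d) hp
  have e3 := mul_le_mul_of_nonneg_left (hV.concave (k + 1) d) hq
  have c0 : receiveCost P α V k (d + 2) + receiveCost P α V k d ≤
      2 * receiveCost P α V k (d + 1) := by
    simp only [receiveCost, ← add_assoc]; linarith
  have c1 : forwardCost P α V k (d + 2) + forwardCost P α V k d ≤
      2 * forwardCost P α V k (d + 1) := by
    simp only [forwardCost]; linarith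
  unfold bellman
  push_cast
  have a1 := min_le_left (receiveCost P α V k (d + 2)) (forwardCost P α V k (d + 2))
  have a2 := min_le_right (receiveCost P α V k (d + 2)) (forwardCost P α V k (d + 2))
  have b1 := min_le_left (receiveCost P α V k d) (forwardCost P α V k d)
  have b2 := min_le_right (receiveCost P α V k d) (forwardCost P α V k d)
  -- Whichever branch attains the middle minimum also bounds the two outer minima from above, so
  -- concavity of that branch suffices.
  rcases min_choice (receiveCost P α V k (d + 1)) (forwardCost P α V k (d + 1)) with h | h <;>
    rw [h] <;> linarith

/-- If forwarding is optimal at (k, d + 1), the left increment is the forwarding one, which is the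
lower bound for the right increment. Otherwise receiving is optimal at (k + 1, d + 1), since the
advantage falls with k, and the right increment is the receiving one. -/
theorem bellman_super (k d : ℕ) :
    bellman P α V k (d + 2) - bellman P α V k (d + 1) ≤
      bellman P α V (k + 1) (d + 1) - bellman P α V (k + 1) d := by
  have hp : 0 ≤ α * (1 - P.p) := mul_nonneg h0 (sub_nonneg.2 P.p_lt.le)
  have hq : 0 ≤ α * (1 - P.q) := mul_nonneg h0 (sub_nonneg.2 P.q_lt.le)
  have e2 := mul_le_mul_of_nonneg_left (hV.super (k + 1) d) hp
  have e3 := mul_le_mul_of_nonneg_left (hV.super (k + 1) d) hq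
  rcases le_total 0 (advantage P α V k (d + 1)) with h | h
  · have h1 := hV.bellman_d_forward h0 h
    have h2 := (hV.bellman_d_bounds h0 (k + 1) d).1
    simp only [show d + 1 + 1 = d + 2 by ring] at h1
    linarith
  · have h1 := (hV.bellman_d_bounds h0 k (d + 1)).2
    have h2 := hV.bellman_d_receive h0 ((hV.advantage_anti_k h0 k (d + 1)).trans h)
    simp only [show d + 1 + 1 = d + 2 by ring, show k + (d + 1) = k + d + 1 by ring] at h1
    simp only [show k + 1 + d = k + d + 1 by ring] at h2
    linarith

/-- The stage cost contributes 1 to each increment in d, hence p + (q - p) = q in total; the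
continuation terms are nonnegative by the old inequalities. When p ≤ q only the weaker slack p is
kept. This positive slack later makes the advantage strictly increasing in d. -/
theorem bellman_gain (k d : ℕ) :
    min P.p P.q ≤ P.p * (bellman P α V 1 (k + d + 1) - bellman P α V 1 (k + d)) +
      (P.q - P.p) * (bellman P α V (k + 1) (d + 1) - bellman P α V (k + 1) d) := by
  have hp0 := P.p_pos
  rcases le_total P.p P.q with hpq | hpq
  · rw [min_eq_left hpq]
    have a1 := mul_le_mul_of_nonneg_left (hV.one_le_bellman_d h0 1 (k + d)) hp0.le
    have a2 := mul_nonneg (sub_nonneg.2 hpq)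
      (zero_le_one.trans (hV.one_le_bellman_d h0 (k + 1) d))
    linarith
  · rw [min_eq_right hpq]
    -- Here q - p ≤ 0, so the second increment needs its upper bound while the first needs its lower
    -- one.
    have a1 := mul_le_mul_of_nonneg_left (hV.bellman_d_bounds h0 1 (k + d)).1 hp0.le
    have a2 := mul_le_mul_of_nonneg_left (hV.bellman_d_bounds h0 (k + 1) d).2 (sub_nonneg.2 hpq)
    have a3 := mul_le_mul_of_nonneg_left (hV.gain (k + 1) d)
      (mul_nonneg h0 (sub_nonneg.2 P.p_lt.le))
    have a4 := mul_le_mul_of_nonneg_left (hV.super 1 (k + d))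
      (mul_nonneg (mul_nonneg h0 P.p_pos.le) (sub_nonneg.2 P.q_lt.le))
    simp only [show k + 1 + d = k + d + 1 by ring, show k + d + 1 + 1 = k + d + 2 by ring,
      show (1 : ℕ) + 1 = 2 by norm_num] at a1 a2 a3 a4
    linarith

/-- The inequality behind the monotonicity in the relay age, with a slack where forwarding is
optimal. -/
theorem bellman_age_of_forward {k d : ℕ} (h : 0 ≤ advantage P α V k d) {m : ℝ}
    (hm1 : m ≤ P.q * (V 1 (k + 1) - V 1 k))
    (hm2 : m ≤ P.p * (V 1 (k + d + 1) - V 1 (k + d)) +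
      (P.q - P.p) * (V (k + 1) (d + 1) - V (k + 1) d)) :
    P.p * (bellman P α V k (d + 1) - bellman P α V k d) +
      (P.q - P.p) * (bellman P α V (k + 1) d - bellman P α V k d) + α * P.p * m ≤
    P.q * (bellman P α V (k + 1) 0 - bellman P α V k 0) := by
  have hp0 := P.p_pos
  have hap := mul_nonneg h0 hp0.le
  rw [hV.bellman_d_forward h0 h, hV.bellman_age_zero h0]
  rcases le_total P.p P.q with hpq | hpq
  · have a1 := mul_le_mul_of_nonneg_left (hV.bellman_k_bounds h0 k d).2 (sub_nonneg.2 hpq)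
    have a2 := mul_le_mul_of_nonneg_left (hV.age (k + 1) d)
      (mul_nonneg h0 (sub_nonneg.2 P.q_lt.le))
    have a3 := mul_le_mul_of_nonneg_left hm1 hap
    simp only [show k + 1 + 1 = k + 2 by ring] at a2
    linarith
  · have a1 := mul_le_mul_of_nonneg_left (hV.bellman_k_bounds h0 k d).1 (sub_nonneg.2 hpq)
    have a2 := mul_le_mul_of_nonneg_left (hV.age (k + 1) d)
      (mul_nonneg h0 (sub_nonneg.2 P.p_lt.le))
    have a3 := mul_le_mul_of_nonneg_left hm2 hap
    have a4 := mul_le_mul_of_nonneg_left (hV.concave_add 1 k d) (mul_nonneg hap P.q_pos.le)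
    simp only [show k + 1 + 1 = k + 2 by ring] at a2
    linarith

theorem bellman_age (k d : ℕ) :
    P.p * (bellman P α V k (d + 1) - bellman P α V k d) +
      (P.q - P.p) * (bellman P α V (k + 1) d - bellman P α V k d) ≤
    P.q * (bellman P α V (k + 1) 0 - bellman P α V k 0) := by
  have hp0 := P.p_pos
  rcases le_total 0 (advantage P α V k d) with h | h
  · have := hV.bellman_age_of_forward h0 h (m := 0)
      (mul_nonneg P.q_pos.le (sub_nonneg.2 (hV.mono 1 k))) (hV.gain k d)
    linarith
  · rw [hV.bellman_k_receive h0 h, hV.bellman_age_zero h0]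
    have a1 := mul_le_mul_of_nonneg_left (hV.bellman_d_bounds h0 k d).2 hp0.le
    have a2 := mul_le_mul_of_nonneg_left (hV.age (k + 1) d)
      (mul_nonneg h0 (sub_nonneg.2 P.p_lt.le))
    have a4 := mul_le_mul_of_nonneg_left (hV.concave_add 1 k d)
      (mul_nonneg (mul_nonneg h0 P.p_pos.le) P.q_pos.le)
    simp only [show k + 1 + 1 = k + 2 by ring] at a2
    linarith

theorem map_bellman : Structured P (bellman P α V) where
  mono k d := by have := hV.one_le_bellman_d h0 k d; linarith
  shift := hV.bellman_shift h0
  concave := hV.bellman_concave h0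
  gain k d := (lt_min P.p_pos P.q_pos).le.trans (hV.bellman_gain h0 k d)
  super := hV.bellman_super h0
  age := hV.bellman_age h0

end Structured

theorem structured_zero : Structured P (fun _ _ => 0) := by
  constructor <;> intros <;> simp

theorem bellman_monotone {α : ℝ} (h0 : 0 ≤ α) {V U : ℕ → ℕ → ℝ} (h : ∀ k d, V k d ≤ U k d)
    (k d : ℕ) : bellman P α V k d ≤ bellman P α U k d := by
  have hp := P.p_pos.le
  have hq := P.q_pos.le
  have hp' := sub_nonneg.2 P.p_lt.le
  have hq' := sub_nonneg.2 P.q_lt.le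
  unfold bellman receiveCost forwardCost
  gcongr <;> apply h

theorem bellman_sub_const (α c : ℝ) (V : ℕ → ℕ → ℝ) (k d : ℕ) :
    bellman P α (fun k d => V k d - c) k d = bellman P α V k d - α * c := by
  unfold bellman
  rw [add_sub_assoc, ← min_sub_sub_right]
  congr 2 <;> simp only [receiveCost, forwardCost] <;> ring

theorem tendsto_bellman {ι : Type*} {l : Filter ι} {α : ι → ℝ} {a : ℝ} {V : ι → ℕ → ℕ → ℝ}
    {U : ℕ → ℕ → ℝ} (hα : Tendsto α l (𝓝 a))
    (hV : ∀ k d, Tendsto (fun i => V i k d) l (𝓝 (U k d))) (k d : ℕ) :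
    Tendsto (fun i => bellman P (α i) (V i) k d) l (𝓝 (bellman P a U k d)) := by
  unfold bellman receiveCost forwardCost
  refine tendsto_const_nhds.add (Tendsto.min ?_ ?_)
  · exact hα.mul (((hV _ _).const_mul _).add ((hV _ _).const_mul _))
  · exact tendsto_const_nhds.add (hα.mul (((hV _ _).const_mul _).add ((hV _ _).const_mul _)))

theorem Structured.of_tendsto {ι : Type*} {l : Filter ι} [l.NeBot] {V : ι → ℕ → ℕ → ℝ}
    {U : ℕ → ℕ → ℝ} (hV : ∀ k d, Tendsto (fun i => V i k d) l (𝓝 (U k d)))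
    (h : ∀ i, Structured P (V i)) : Structured P U where
  mono k d := le_of_tendsto_of_tendsto' (hV _ _) (hV _ _) fun i => (h i).mono k d
  shift k d := le_of_tendsto_of_tendsto' (hV _ _) (hV _ _) fun i => (h i).shift k d
  concave k d := le_of_tendsto_of_tendsto' ((hV _ _).sub (hV _ _)) ((hV _ _).sub (hV _ _))
    fun i => (h i).concave k d
  gain k d := ge_of_tendsto' ((((hV _ _).sub (hV _ _)).const_mul _).add
    (((hV _ _).sub (hV _ _)).const_mul _)) fun i => (h i).gain k d
  super k d := le_of_tendsto_of_tendsto' ((hV _ _).sub (hV _ _)) ((hV _ _).sub (hV _ _))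
    fun i => (h i).super k d
  age k d := le_of_tendsto_of_tendsto' ((((hV _ _).sub (hV _ _)).const_mul _).add
    (((hV _ _).sub (hV _ _)).const_mul _)) (((hV _ _).sub (hV _ _)).const_mul _)
    fun i => (h i).age k d

theorem Structured.sub_const {V : ℕ → ℕ → ℝ} (h : Structured P V) (c : ℝ) :
    Structured P (fun k d => V k d - c) where
  mono k d := sub_le_sub_right (h.mono k d) c
  shift k d := sub_le_sub_right (h.shift k d) c
  concave k d := by simpa only [sub_sub_sub_cancel_right] using h.concave k d
  gain k d := by simpa only [sub_sub_sub_cancel_right] using h.gain k d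
  super k d := by simpa only [sub_sub_sub_cancel_right] using h.super k d
  age k d := by simpa only [sub_sub_sub_cancel_right] using h.age k d

/-! ### Increment bounds and a linear supersolution -/

/-- Uniform bounds on the increments of a value function. -/
structure IncrementBound (V : ℕ → ℕ → ℝ) (B : ℝ) : Prop where
  d : ∀ k d, V k (d + 1) - V k d ≤ B
  k : ∀ k, V (k + 1) 0 - V k 0 ≤ B

theorem IncrementBound.le {V : ℕ → ℕ → ℝ} {B : ℝ} (h : IncrementBound V B) (k d : ℕ) :
    V k d ≤ V 0 0 + B * (k + d) := by
  have h1 : V k 0 ≤ V 0 0 + B * k := by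
    induction k with
    | zero => simp
    | succ k ih => have := h.k k; push_cast; linarith
  induction d with
  | zero => simpa using h1
  | succ d ih => have := h.d k d; push_cast; linarith

theorem Structured.incrementBound_bellman {V : ℕ → ℕ → ℝ} (hV : Structured P V) {α X B : ℝ}
    (h0 : 0 ≤ α) (hX : ∀ m, V 1 (m + 1) - V 1 m ≤ X) (hB : IncrementBound V B) :
    IncrementBound (RelayAoI.bellman P α V) (1 + α * (P.p * X + (1 - P.p) * B)) := by
  have hp := P.p_pos.le
  have hp' := sub_nonneg.2 P.p_lt.le
  constructor
  · intro k d
    refine (hV.bellman_d_bounds h0 k d).2.trans ?_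
    have := hX (k + d)
    have := hB.d (k + 1) d
    gcongr
  · intro k
    rw [hV.bellman_age_zero h0]
    have := hX k
    have := hB.k (k + 1)
    gcongr

/-- The growth rate, in the relay age, of a linear supersolution of the optimality equation. -/
noncomputable def slope (P : Params) : ℝ := 2 / P.p + 2 / P.q

theorem slope_pos : 0 < slope P := by
  have := P.p_pos
  have := P.q_pos
  unfold slope; positivity

/-- A supersolution of the discounted optimality equation. -/
noncomputable def superCost (P : Params) (α : ℝ) (k d : ℕ) : ℝ :=
  (P.lam + slope P) / (1 - α) + slope P * k + 2 / P.q * d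

theorem superCost_nonneg {α : ℝ} (h1 : α < 1) (k d : ℕ) : 0 ≤ superCost P α k d := by
  have := P.q_pos
  have := P.lam_nonneg
  have := slope_pos (P := P)
  have := sub_pos.2 h1
  unfold superCost; positivity

theorem bellman_superCost_le {α : ℝ} (h1 : α < 1) (k d : ℕ) :
    bellman P α (superCost P α) k d ≤ superCost P α k d := by
  have hp := P.p_pos
  have hq := P.q_pos
  have hs := slope_pos (P := P)
  have hl := P.lam_nonneg
  have hk : (0 : ℝ) ≤ k := Nat.cast_nonneg k
  have hd : (0 : ℝ) ≤ d := Nat.cast_nonneg d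
  have ha := sub_pos.2 h1
  have hp' := sub_nonneg.2 P.p_lt.le
  have hq' := sub_nonneg.2 P.q_lt.le
  have hG : (P.lam + slope P) / (1 - α) = P.lam + slope P + α * ((P.lam + slope P) / (1 - α)) := by
    field_simp; ring
  set c := (P.lam + slope P) / (1 - α) with hc
  have e1 : P.q * (2 / P.q) = 2 := by field_simp
  have e2 : P.p * (slope P - 2 / P.q) = 2 := by unfold slope; field_simp; ring
  set s := slope P
  set b := 2 / P.q
  have hb : 0 ≤ b := by positivity
  -- The slopes are chosen so that receiving lowers the linear part by 2k in expectation and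
  -- forwarding by 2d, apart from the drift s of ageing. Taking the action belonging to the larger
  -- of k and d pays for the stage cost k + d; the constant term absorbs s and the multiplier.
  rcases le_total d k with h | h
  · have h' : (d : ℝ) ≤ k := by exact_mod_cast h
    have key : P.p * (s + b * (k + d)) + (1 - P.p) * (s * (k + 1) + b * d) + k + d ≤
        s + s * k + b * d := by
      linear_combination h' - k * e2
    have nn : 0 ≤ P.p * (s + b * (k + d)) + (1 - P.p) * (s * (k + 1) + b * d) := by positivity
    have := mul_le_of_le_one_left nn h1.le
    refine (add_le_add_right (min_le_left _ _) _).trans ?_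
    unfold receiveCost superCost
    push_cast
    linarith
  · have h' : (k : ℝ) ≤ d := by exact_mod_cast h
    have key : P.q * (s * (k + 1)) + (1 - P.q) * (s * (k + 1) + b * d) + k + d ≤
        s + s * k + b * d := by
      linear_combination h' - d * e1
    have nn : 0 ≤ P.q * (s * (k + 1)) + (1 - P.q) * (s * (k + 1) + b * d) := by positivity
    have := mul_le_of_le_one_left nn h1.le
    refine (add_le_add_right (min_le_right _ _) _).trans ?_
    unfold forwardCost superCost
    push_cast
    linarith

/-! ### Discounted value functions -/

/-- Value iteration from the zero function. -/
noncomputable def valueIter (P : Params) (α : ℝ) : ℕ → ℕ → ℕ → ℝ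
  | 0 => fun _ _ => 0
  | n + 1 => bellman P α (valueIter P α n)

section Discounted
variable {α : ℝ} (h0 : 0 ≤ α)
include h0

theorem structured_valueIter (n : ℕ) : Structured P (valueIter P α n) := by
  induction n with
  | zero => exact structured_zero
  | succ n ih => exact ih.map_bellman h0

theorem valueIter_le_succ (n k d : ℕ) : valueIter P α n k d ≤ valueIter P α (n + 1) k d := by
  induction n generalizing k d with
  | zero =>
    have hl := P.lam_nonneg
    simp only [valueIter, bellman, receiveCost, forwardCost]
    have : (0 : ℝ) ≤ min (α * (P.p * 0 + (1 - P.p) * 0)) (P.lam + α * (P.q * 0 + (1 - P.q) * 0)) :=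
      le_min (by simp) (by simpa using hl)
    positivity
  | succ n ih => exact bellman_monotone h0 ih k d

theorem valueIter_le_superCost (h1 : α < 1) (n k d : ℕ) :
    valueIter P α n k d ≤ superCost P α k d := by
  induction n generalizing k d with
  | zero => exact superCost_nonneg h1 k d
  | succ n ih => exact (bellman_monotone h0 ih k d).trans (bellman_superCost_le h1 k d)

/-- This bound blows up as α tends to 1. It serves only as a finite starting point for the
contraction in `Structured.incrementBound_of_fixed`. -/
theorem incrementBound_valueIter (h1 : α < 1) (n : ℕ) :
    IncrementBound (valueIter P α n) (1 / (1 - α)) := by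
  have ha := sub_pos.2 h1
  induction n with
  | zero => constructor <;> intros <;> simp [valueIter, h1.le]
  | succ n ih =>
    have := (structured_valueIter (P := P) h0 n).incrementBound_bellman h0 (ih.d 1) ih
    have e : 1 + α * (P.p * (1 / (1 - α)) + (1 - P.p) * (1 / (1 - α))) = 1 / (1 - α) := by
      field_simp; ring
    rwa [e] at this

theorem exists_discounted_value (h1 : α < 1) : ∃ V : ℕ → ℕ → ℝ, Structured P V ∧
    bellman P α V = V ∧ IncrementBound V (1 / (1 - α)) ∧
    ∀ k d, V k d ≤ superCost P α k d := by
  have hlim : ∀ k d, Tendsto (fun n => valueIter P α n k d) atTop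
      (𝓝 (⨆ n, valueIter P α n k d)) := fun k d =>
    tendsto_atTop_ciSup (monotone_nat_of_le_succ fun n => valueIter_le_succ h0 n k d)
      ⟨superCost P α k d, by rintro _ ⟨n, rfl⟩; exact valueIter_le_superCost h0 h1 n k d⟩
  refine ⟨fun k d => ⨆ n, valueIter P α n k d, .of_tendsto hlim (structured_valueIter h0), ?_, ?_,
    fun k d => le_of_tendsto' (hlim k d) fun n => valueIter_le_superCost h0 h1 n k d⟩
  · funext k d
    exact tendsto_nhds_unique (tendsto_bellman tendsto_const_nhds hlim k d)
      ((tendsto_add_atTop_iff_nat 1).2 (hlim k d))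
  · exact ⟨fun k d => le_of_tendsto' ((hlim _ _).sub (hlim _ _))
      fun n => (incrementBound_valueIter h0 h1 n).d k d,
      fun k => le_of_tendsto' ((hlim _ _).sub (hlim _ _))
      fun n => (incrementBound_valueIter h0 h1 n).k k⟩

end Discounted

/-! ### Vanishing discount -/

theorem Structured.incrementBound_of_fixed {V : ℕ → ℕ → ℝ} (hV : Structured P V) {α X B : ℝ}
    (h0 : 0 ≤ α) (h1 : α < 1) (hfix : RelayAoI.bellman P α V = V)
    (hX : V 1 1 - V 1 0 ≤ X) (hB : IncrementBound V B) :
    IncrementBound V (1 / P.p + X) := by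
  have hp := P.p_pos
  have hp' := sub_nonneg.2 P.p_lt.le
  have hB0 : 0 ≤ B := (sub_nonneg.2 (hV.mono 0 0)).trans (hB.d 0 0)
  have hX0 : 0 ≤ X := (sub_nonneg.2 (hV.mono 1 0)).trans hX
  have hX' : ∀ m, V 1 (m + 1) - V 1 m ≤ X := fun m => by
    have := hV.concave_add 1 0 m
    simp only [zero_add] at this
    exact this.trans hX
  -- At a fixed point a bound B improves to 1 + pX + (1 - p)B, an affine contraction with fixed
  -- point 1/p + X. Iterating removes the dependence on B, and with it that on α.
  have key : ∀ n : ℕ, IncrementBound V (1 / P.p + X + (1 - P.p) ^ n * B) := by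
    intro n
    induction n with
    | zero =>
      have : 0 ≤ 1 / P.p + X := by positivity
      exact ⟨fun k d => (hB.d k d).trans (by simpa using this),
        fun k => (hB.k k).trans (by simpa using this)⟩
    | succ n ih =>
      have h := hV.incrementBound_bellman h0 hX' ih
      rw [hfix] at h
      have hle : 1 + α * (P.p * X + (1 - P.p) * (1 / P.p + X + (1 - P.p) ^ n * B)) ≤
          1 / P.p + X + (1 - P.p) ^ (n + 1) * B := by
        have : α * (P.p * X + (1 - P.p) * (1 / P.p + X + (1 - P.p) ^ n * B)) ≤
            P.p * X + (1 - P.p) * (1 / P.p + X + (1 - P.p) ^ n * B) :=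
          mul_le_of_le_one_left (by positivity) h1.le
        refine (add_le_add_right this 1).trans (le_of_eq ?_)
        field_simp
        ring
      exact ⟨fun k d => (h.d k d).trans hle, fun k => (h.k k).trans hle⟩
  have hlim : Tendsto (fun n : ℕ => 1 / P.p + X + (1 - P.p) ^ n * B) atTop
      (𝓝 (1 / P.p + X)) := by
    have := ((tendsto_pow_atTop_nhds_zero_of_lt_one hp' (by linarith)).mul_const B).const_add
      (1 / P.p + X)
    simpa using this
  exact ⟨fun k d => ge_of_tendsto' hlim fun n => (key n).d k d,
    fun k => ge_of_tendsto' hlim fun n => (key n).k k⟩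

/-- A bound, uniform in the discount factor, on the increments of the discounted value functions. -/
noncomputable def growth (P : Params) : ℝ := 1 / P.p + 2 * (P.lam + 2 * slope P) / P.p

theorem exists_relative_value {α : ℝ} (h0 : 1 / 2 ≤ α) (h1 : α < 1) :
    ∃ (h : ℕ → ℕ → ℝ) (g : ℝ), Structured P h ∧ (∀ k d, bellman P α h k d = h k d + g) ∧
      (∀ k d : ℕ, h k d ∈ Set.Icc 0 (growth P * (k + d))) ∧ g ∈ Set.Icc 0 (P.lam + slope P) := by
  have hα : 0 ≤ α := by linarith
  have ha := sub_pos.2 h1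
  have hp := P.p_pos
  have hs := slope_pos (P := P)
  obtain ⟨V, hV, hfix, hB, hle⟩ := exists_discounted_value (P := P) hα h1
  have h10 : (1 - α) * V 1 0 ≤ P.lam + 2 * slope P := by
    have := mul_le_mul_of_nonneg_left (hle 1 0) ha.le
    have e : (1 - α) * superCost P α 1 0 = P.lam + slope P + (1 - α) * slope P := by
      unfold superCost; push_cast; field_simp; ring
    nlinarith
  -- In the equation at (1, 0), replacing V(2, 0) by the smaller V(1, 0) leaves αp(V(1,1) - V(1,0))
  -- ≤ (1-α)V(1,0). The factor 2 comes from α ≥ 1/2.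
  have hX : V 1 1 - V 1 0 ≤ 2 * (P.lam + 2 * slope P) / P.p := by
    have e : V 1 0 = 1 + α * (P.p * V 1 1 + (1 - P.p) * V 2 0) := by
      have := hV.bellman_zero hα 1
      rw [hfix] at this
      simpa using this
    have e2 := mul_le_mul_of_nonneg_left (hV.mono_k 1 0)
      (mul_nonneg hα (sub_nonneg.2 P.p_lt.le))
    have e3 := mul_nonneg (mul_nonneg (sub_nonneg.2 h0) hp.le) (sub_nonneg.2 (hV.mono 1 0))
    rw [le_div_iff₀ hp]
    simp only [zero_add, show (1 : ℕ) + 1 = 2 by norm_num] at e2 e3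
    linarith
  have hB' := hV.incrementBound_of_fixed hα h1 hfix hX hB
  have h00 : 0 ≤ V 0 0 := by
    have e : V 0 0 = α * V 1 0 := by
      have := hV.bellman_zero hα 0
      rw [hfix] at this
      rw [this]; push_cast; ring_nf
    have := hV.mono_k 0 0
    simp only [zero_add] at this
    nlinarith
  refine ⟨fun k d => V k d - V 0 0, (1 - α) * V 0 0, hV.sub_const _, fun k d => ?_,
    fun k d => ⟨sub_nonneg.2 (hV.le_of_le (Nat.zero_le k) (Nat.zero_le d)), ?_⟩,
    mul_nonneg ha.le h00, ?_⟩
  · rw [bellman_sub_const, hfix]; ring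
  · have := hB'.le k d
    unfold growth
    linarith
  · have := mul_le_mul_of_nonneg_left (hle 0 0) ha.le
    refine this.trans (le_of_eq ?_)
    unfold superCost; push_cast; field_simp; ring

/-- The average cost optimality equation has a structured solution of linear growth. -/
theorem exists_average_solution (P : Params) :
    ∃ (h : ℕ → ℕ → ℝ) (g : ℝ), Structured P h ∧ (∀ k d, bellman P 1 h k d = h k d + g) ∧
      (∀ k d : ℕ, h k d ∈ Set.Icc 0 (growth P * (k + d))) ∧ 0 ≤ g := by
  let α : ℕ → ℝ := fun n => 1 - 1 / (n + 2)
  have hα : Tendsto α atTop (𝓝 1) := by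
    have : Tendsto (fun n : ℕ => 1 / ((n : ℝ) + 2)) atTop (𝓝 0) :=
      tendsto_const_nhds.div_atTop
        (tendsto_atTop_add_const_right _ _ tendsto_natCast_atTop_atTop)
    simpa [α] using this.const_sub 1
  have hhalf : ∀ n, 1 / 2 ≤ α n := fun n => by
    have : 1 / ((n : ℝ) + 2) ≤ 1 / 2 :=
      one_div_le_one_div_of_le (by norm_num) (by have := Nat.cast_nonneg (α := ℝ) n; linarith)
    simp only [α]; linarith
  have hlt : ∀ n, α n < 1 := fun n => by
    have : 0 < 1 / ((n : ℝ) + 2) := by positivity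
    simp only [α]; linarith
  choose h g hs hb hh hg using fun n => exists_relative_value (P := P) (hhalf n) (hlt n)
  -- A limit along an ultrafilter makes all values and the constants converge at once, in place of a
  -- diagonal subsequence.
  let U : Ultrafilter ℕ := hyperfilter ℕ
  have hU : (U : Filter ℕ) ≤ atTop := by
    rw [← Nat.cofinite_eq_atTop]; exact hyperfilter_le_cofinite
  have lim : ∀ {x : ℕ → ℝ} {b : ℝ}, (∀ n, x n ∈ Set.Icc 0 b) →
      ∃ y ∈ Set.Icc 0 b, Tendsto x U (𝓝 y) := fun {x b} hx =>
    isCompact_Icc.ultrafilter_le_nhds (U.map x)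
      (le_principal_iff.2 (show ∀ᶠ n in U, x n ∈ Set.Icc 0 b from .of_forall hx))
  choose H hH hHlim using fun k d => lim (fun n => hh n k d)
  obtain ⟨γ, hγ, hγlim⟩ := lim hg
  exact ⟨H, γ, .of_tendsto hHlim hs, fun k d => tendsto_nhds_unique
    (tendsto_bellman (hα.mono_left hU) hHlim k d)
    (((hHlim k d).add hγlim).congr fun n => (hb n k d).symm), hH, hγ.1⟩

/-! ### Strict monotonicity and signs of the advantage -/

section Strict

variable {h : ℕ → ℕ → ℝ} {g : ℝ} (hs : Structured P h)
  (hb : ∀ k d, bellman P 1 h k d = h k d + g)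
include hs hb

theorem advantage_add_le (k d : ℕ) :
    advantage P 1 h k d + min P.p P.q ≤ advantage P 1 h k (d + 1) := by
  have h1 := hs.bellman_gain zero_le_one k d
  simp only [hb, add_sub_add_right_eq_sub] at h1
  have := advantage_succ_sub (P := P) h 1 k d
  linarith

theorem advantage_strictMono (k : ℕ) : StrictMono (advantage P 1 h k) :=
  strictMono_nat_of_lt_succ fun d => by
    have := advantage_add_le hs hb k d
    have := lt_min P.p_pos P.q_pos
    linarith

/-- At a fixed point, `bellman_age_of_forward` applies with a positive slack m, but only where
forwarding is optimal. This restricted strictness is enough: it is used only to exclude a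
nonnegative advantage at an older age. -/
theorem advantage_succ_add_le {k d : ℕ} (hA : 0 ≤ advantage P 1 h (k + 1) d) :
    advantage P 1 h (k + 1) d + P.p * (min P.p P.q * P.q) ≤ advantage P 1 h k d := by
  have hp := P.p_pos
  have hq := P.q_pos
  have hm := lt_min hp hq
  have e1 := hs.one_le_bellman_d zero_le_one 1 (k + 1)
  have e2 := hs.bellman_gain zero_le_one (k + 1) d
  have := hs.bellman_age_of_forward zero_le_one hA (m := min P.p P.q * P.q) ?_ ?_
  · simp only [hb, add_sub_add_right_eq_sub, show k + 1 + 1 = k + 2 by ring] at this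
    have h2 := hs.advantage_age 1 zero_le_one k d
    linarith
  · simp only [hb, add_sub_add_right_eq_sub] at e1
    have := P.p_lt
    have : min P.p P.q ≤ 1 := (min_le_left _ _).trans this.le
    nlinarith
  · simp only [hb, add_sub_add_right_eq_sub] at e2
    refine le_trans ?_ e2
    exact mul_le_of_le_one_right hm.le P.q_lt.le

theorem exists_advantage_neg (d : ℕ) : ∃ K, ∀ k, K ≤ k → advantage P 1 h k d < 0 := by
  have hm : 0 < P.p * (min P.p P.q * P.q) :=
    mul_pos P.p_pos (mul_pos (lt_min P.p_pos P.q_pos) P.q_pos)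
  have hanti : Antitone fun k => advantage P 1 h k d :=
    antitone_nat_of_succ_le fun k => hs.advantage_anti_k zero_le_one k d
  by_contra! hcon
  have hnn : ∀ k, 0 ≤ advantage P 1 h k d := fun k => by
    obtain ⟨k', hk, h'⟩ := hcon k
    exact h'.trans (hanti hk)
  have : ∀ k : ℕ, advantage P 1 h k d + k * (P.p * (min P.p P.q * P.q)) ≤ advantage P 1 h 0 d := by
    intro k
    induction k with
    | zero => simp
    | succ k ih =>
      have := advantage_succ_add_le hs hb (hnn (k + 1))
      push_cast
      linarith
  obtain ⟨n, hn⟩ := exists_nat_gt (advantage P 1 h 0 d / (P.p * (min P.p P.q * P.q)))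
  rw [div_lt_iff₀ hm] at hn
  linarith [this n, hnn n]

theorem exists_advantage_pos (k : ℕ) : ∃ M, ∀ d, M ≤ d → 0 < advantage P 1 h k d := by
  have hm := lt_min P.p_pos P.q_pos
  have : ∀ d : ℕ, advantage P 1 h k 0 + d * min P.p P.q ≤ advantage P 1 h k d := by
    intro d
    induction d with
    | zero => simp
    | succ d ih =>
      have := advantage_add_le hs hb k d
      push_cast
      linarith
  obtain ⟨n, hn⟩ := exists_nat_gt (-advantage P 1 h k 0 / min P.p P.q)
  rw [div_lt_iff₀ hm] at hn
  refine ⟨n, fun d hd => ?_⟩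
  have : (n : ℝ) * min P.p P.q ≤ d * min P.p P.q := by gcongr
  linarith [‹∀ d : ℕ, _› d]

/-- With no gain, forwarding is useless, but for zero multiplier a tie must still be excluded: a tie
would mean h(1, k) = h(k + 1, 0). Strictness matters because it forces an optimal policy to receive
at (k, 0), and so to reach (1, k). -/
theorem advantage_zero_neg {k : ℕ} (hk : 2 ≤ k) : advantage P 1 h k 0 < 0 := by
  have hp := P.p_pos
  have hle := hs.fresh_le k
  have e : advantage P 1 h k 0 = P.p * (h 1 k - h (k + 1) 0) - P.lam := by
    simp only [advantage, receiveCost, forwardCost, add_zero]; ring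
  rcases hle.lt_or_eq with hlt | heq
  · rw [e]; nlinarith [P.lam_nonneg]
  rcases P.lam_nonneg.lt_or_eq with hl | hl
  · rw [e, heq]; linarith
  exfalso
  obtain ⟨j, rfl⟩ : ∃ j, k = j + 1 + 1 := ⟨k - 2, by omega⟩
  -- Were forwarding strictly better at (1, k), then h(1, k) would fall strictly below the cost of
  -- receiving there, which is at most h(k + 1, 0).
  have hrec : advantage P 1 h 1 (j + 1 + 1) ≤ 0 := by
    by_contra! hpos
    have hb1 := hb 1 (j + 1 + 1)
    have hb2 := hs.bellman_zero zero_le_one (j + 1 + 1 + 1)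
    rw [hb] at hb2
    unfold advantage at hpos
    rw [bellman, min_eq_right (by linarith)] at hb1
    have h3 := mul_le_mul_of_nonneg_left (hs.shift_add 2 0 (j + 1 + 1))
      (sub_nonneg.2 P.p_lt.le)
    simp only [zero_add, show 2 + (j + 1 + 1) = j + 1 + 1 + 1 + 1 by ring] at h3
    simp only [receiveCost, show 1 + (j + 1 + 1) = j + 1 + 1 + 1 by ring,
      show (1 : ℕ) + 1 = 2 by norm_num] at hpos
    push_cast at hb1 hb2
    linarith
  have hneg := (advantage_strictMono hs hb 1 (Nat.lt_succ_self (j + 1))).trans_le hrec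
  have h1 := hs.shift 1 (j + 1)
  have h2 := hs.shift_add 2 0 (j + 1)
  have h3 : h 2 0 ≤ h (j + 1 + 1 + 1) 0 := hs.le_of_le (by omega) le_rfl
  simp only [zero_add, show 2 + (j + 1) = j + 1 + 1 + 1 by ring,
    show (1 : ℕ) + 1 = 2 by norm_num] at h1 h2
  -- h(2, k - 1) is squeezed between the equal values h(1, k) and h(k + 1, 0). The advantage at (1,
  -- k - 1) then equals q(h(k + 1, 0) - h(2, 0)) ≥ 0, contradicting `hneg`.
  have e2 : h 2 (j + 1) = h (j + 1 + 1 + 1) 0 := le_antisymm h2 (heq ▸ h1)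
  simp only [advantage, receiveCost, forwardCost, show 1 + (j + 1) = j + 1 + 1 by ring,
    show (1 : ℕ) + 1 = 2 by norm_num, heq, e2, ← hl] at hneg
  nlinarith [P.q_pos]

end Strict

/-! ### Expectations, mean age and visit frequencies of the controlled chain -/

section Expectation

theorem expect_mono {μ : PMF State} {f f' : State → ℝ≥0∞} (h : ∀ v, f v ≤ f' v) :
    expect μ f ≤ expect μ f' :=
  ENNReal.tsum_le_tsum fun v => mul_le_mul_right (h v) _

theorem expect_add (μ : PMF State) (f f' : State → ℝ≥0∞) :
    expect μ (fun v => f v + f' v) = expect μ f + expect μ f' := by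
  simp only [expect, mul_add, ENNReal.tsum_add]

theorem expect_const (μ : PMF State) (c : ℝ≥0∞) : expect μ (fun _ => c) = c := by
  rw [expect, ENNReal.tsum_mul_right, μ.tsum_coe, one_mul]

theorem expect_const_mul (μ : PMF State) (c : ℝ≥0∞) (f : State → ℝ≥0∞) :
    expect μ (fun v => c * f v) = c * expect μ f := by
  simp only [expect, mul_left_comm _ c, ENNReal.tsum_mul_left]

theorem expect_pure (s : State) (f : State → ℝ≥0∞) : expect (PMF.pure s) f = f s := by
  rw [expect, tsum_eq_single s]
  · simp
  · intro v hv; simp [hv]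

theorem tsum_bind_mul {α β : Type*} (μ : PMF α) (κ : α → PMF β) (f : β → ℝ≥0∞) :
    ∑' b, (μ.bind κ) b * f b = ∑' a, μ a * ∑' b, κ a b * f b := by
  simp only [PMF.bind_apply, ← ENNReal.tsum_mul_right, ← ENNReal.tsum_mul_left]
  rw [ENNReal.tsum_comm]
  simp only [mul_assoc]

theorem tsum_map_mul {α β : Type*} (μ : PMF α) (e : α → β) (f : β → ℝ≥0∞) :
    ∑' b, (μ.map e) b * f b = ∑' a, μ a * f (e a) := by
  rw [PMF.map, tsum_bind_mul]
  refine tsum_congr fun a => ?_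
  rw [tsum_eq_single (e a)]
  · simp
  · intro b hb; simp [hb]

theorem mul_le_expect (μ : PMF State) (f : State → ℝ≥0∞) (v : State) : μ v * f v ≤ expect μ f :=
  ENNReal.le_tsum v

end Expectation

section Dynamics

variable (p q : unitInterval)

theorem expect_transition (v : State) (w : Action) {F : State → ℝ} (hF : ∀ v, 0 ≤ F v) :
    expect (transition p q v w) (fun u => ENNReal.ofReal (F u)) =
      ENNReal.ofReal (p * (q * F (nextState v w true true) +
        (1 - q) * F (nextState v w true false)) +
        (1 - p) * (q * F (nextState v w false true) +
        (1 - q) * F (nextState v w false false))) := by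
  have hp := p.2.1
  have hq := q.2.1
  have hp' := sub_nonneg.2 p.2.2
  have hq' := sub_nonneg.2 q.2.2
  have key : ∀ r : unitInterval, ∀ x y : ℝ, 0 ≤ x → 0 ≤ y →
      ∑' b, linkLaw r b * ENNReal.ofReal (if b then x else y) =
        ENNReal.ofReal (r * x + (1 - r) * y) := by
    intro r x y hx hy
    have hr := r.2.1
    have hr' := sub_nonneg.2 r.2.2
    rw [tsum_fintype, Fintype.sum_bool]
    simp only [linkLaw, PMF.ofFintype_apply, if_true, Bool.false_eq_true, if_false]
    rw [← ENNReal.ofReal_mul hr, ← ENNReal.ofReal_mul hr',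
      ← ENNReal.ofReal_add (mul_nonneg hr hx) (mul_nonneg hr' hy)]
  have inner : ∀ b, ∑' b', linkLaw q b' * ENNReal.ofReal (F (nextState v w b b')) =
      ENNReal.ofReal (q * F (nextState v w b true) + (1 - q) * F (nextState v w b false)) := by
    intro b
    rw [← key q _ _ (hF _) (hF _)]
    refine tsum_congr fun b' => ?_
    cases b' <;> simp
  rw [expect, transition, tsum_bind_mul]
  simp only [tsum_map_mul, inner]
  rw [← key p _ _ (add_nonneg (mul_nonneg hq (hF _)) (mul_nonneg hq' (hF _)))
    (add_nonneg (mul_nonneg hq (hF _)) (mul_nonneg hq' (hF _)))]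
  refine tsum_congr fun b => ?_
  cases b <;> simp

theorem expect_transition_receive {h : ℕ → ℕ → ℝ} (hh : ∀ k d, 0 ≤ h k d) (v : State) :
    expect (transition p q v 0) (fun u => ENNReal.ofReal (h u.k u.d)) =
      ENNReal.ofReal (p * h 1 (v.k + v.d) + (1 - p) * h (v.k + 1) v.d) := by
  rw [expect_transition p q v 0 (F := fun u => h u.k u.d) fun u => hh _ _]
  congr 1
  simp [nextState, nextAge, nextGain]
  ring

theorem expect_transition_forward {h : ℕ → ℕ → ℝ} (hh : ∀ k d, 0 ≤ h k d) (v : State) :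
    expect (transition p q v 1) (fun u => ENNReal.ofReal (h u.k u.d)) =
      ENNReal.ofReal (q * h (v.k + 1) 0 + (1 - q) * h (v.k + 1) v.d) := by
  rw [expect_transition p q v 1 (F := fun u => h u.k u.d) fun u => hh _ _]
  congr 1
  simp [nextState, nextAge, nextGain]
  ring

variable {p q} in
theorem transition_nextState_ne_zero (hp0 : 0 < p) (hp1 : p < 1) (hq0 : 0 < q) (hq1 : q < 1)
    (v : State) (w : Action) (b b' : Bool) : transition p q v w (nextState v w b b') ≠ 0 := by
  have key : ∀ r : unitInterval, 0 < r → r < 1 → ∀ b, b ∈ (linkLaw r).support := by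
    intro r h0 h1 b
    have h0' : (0 : ℝ) < r := h0
    have h1' : (r : ℝ) < 1 := h1
    rw [PMF.mem_support_iff]
    cases b <;> simpa [linkLaw]
  rw [← PMF.mem_support_iff, transition, PMF.mem_support_bind_iff]
  refine ⟨b, key p hp0 hp1 b, ?_⟩
  rw [PMF.mem_support_map_iff]
  exact ⟨b', key q hq0 hq1 b', rfl⟩

variable (θ : Policy) (s₀ : State)

theorem expect_stateLaw_succ (t : ℕ) (f : State → ℝ≥0∞) :
    expect (stateLaw p q θ s₀ (t + 1)) f =
      expect (stateLaw p q θ s₀ t) fun v => expect (transition p q v (θ v)) f := by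
  simp only [expect, stateLaw, tsum_bind_mul]

theorem le_stateLaw_succ (t : ℕ) (v u : State) :
    stateLaw p q θ s₀ t v * transition p q v (θ v) u ≤ stateLaw p q θ s₀ (t + 1) u := by
  rw [stateLaw, PMF.bind_apply]
  exact ENNReal.le_tsum (f := fun v => stateLaw p q θ s₀ t v * transition p q v (θ v) u) v

/-- The age at the destination. -/
noncomputable def destAge (v : State) : ℝ≥0∞ := (v.k : ℝ≥0∞) + (v.d : ℝ≥0∞)

theorem destAge_eq (v : State) : destAge v = ENNReal.ofReal ((v.k : ℝ) + v.d) := by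
  rw [destAge, ENNReal.ofReal_add (by positivity) (by positivity), ENNReal.ofReal_natCast,
    ENNReal.ofReal_natCast]

theorem expect_transition_destAge_le (v : State) (w : Action) :
    expect (transition p q v w) destAge ≤ destAge v + 1 := by
  have hq := q.2.1
  have hq' := sub_nonneg.2 q.2.2
  have e : destAge = fun u : State => ENNReal.ofReal ((fun k d : ℕ => (k : ℝ) + d) u.k u.d) :=
    funext destAge_eq
  have e1 : destAge v + 1 = ENNReal.ofReal ((v.k : ℝ) + v.d + 1) := by
    rw [destAge_eq, ENNReal.ofReal_add (by positivity) zero_le_one, ENNReal.ofReal_one]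
  have hnn : ∀ k d : ℕ, (0 : ℝ) ≤ (fun k d : ℕ => (k : ℝ) + d) k d := fun k d => by positivity
  rw [e1, e]
  fin_cases w
  · refine (expect_transition_receive p q hnn v).trans_le (ENNReal.ofReal_le_ofReal (le_of_eq ?_))
    push_cast; ring
  · refine (expect_transition_forward p q hnn v).trans_le (ENNReal.ofReal_le_ofReal ?_)
    push_cast
    nlinarith [mul_nonneg hq (Nat.cast_nonneg (α := ℝ) v.d)]

theorem expect_destAge_succ_le (t : ℕ) : expect (stateLaw p q θ s₀ (t + 1)) destAge ≤
    expect (stateLaw p q θ s₀ t) destAge + 1 := by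
  rw [expect_stateLaw_succ]
  refine (expect_mono fun v => expect_transition_destAge_le p q v (θ v)).trans (le_of_eq ?_)
  rw [expect_add, expect_const]

theorem expect_destAge_ne_top (t : ℕ) : expect (stateLaw p q θ s₀ t) destAge ≠ ∞ := by
  induction t with
  | zero => rw [stateLaw, expect_pure, destAge_eq]; exact ENNReal.ofReal_ne_top
  | succ t ih =>
    exact ne_top_of_le_ne_top (ENNReal.add_ne_top.2 ⟨ih, ENNReal.one_ne_top⟩)
      (expect_destAge_succ_le p q θ s₀ t)

/-- The expected age at the destination in slot `t`. -/
noncomputable def meanAge (t : ℕ) : ℝ := (expect (stateLaw p q θ s₀ t) destAge).toReal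

theorem ofReal_meanAge (t : ℕ) :
    ENNReal.ofReal (meanAge p q θ s₀ t) = expect (stateLaw p q θ s₀ t) destAge :=
  ENNReal.ofReal_toReal (expect_destAge_ne_top p q θ s₀ t)

theorem meanAge_nonneg (t : ℕ) : 0 ≤ meanAge p q θ s₀ t := ENNReal.toReal_nonneg

theorem meanAge_succ_le (t : ℕ) : meanAge p q θ s₀ (t + 1) ≤ meanAge p q θ s₀ t + 1 := by
  have h := ENNReal.toReal_mono
    (ENNReal.add_ne_top.2 ⟨expect_destAge_ne_top p q θ s₀ t, ENNReal.one_ne_top⟩)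
    (expect_destAge_succ_le p q θ s₀ t)
  rwa [ENNReal.toReal_add (expect_destAge_ne_top p q θ s₀ t) ENNReal.one_ne_top,
    ENNReal.toReal_one] at h

/-- The expected number of visits to `v` before slot `T`. -/
noncomputable def visits (v : State) (T : ℕ) : ℝ :=
  ∑ t ∈ Finset.range T, (stateLaw p q θ s₀ t v).toReal

/-- The state `v` is visited with a frequency that does not vanish. -/
def Frequent (v : State) : Prop :=
  ¬ Tendsto (fun T : ℕ => visits p q θ s₀ v T / T) atTop (𝓝 0)

theorem visits_nonneg (v : State) (T : ℕ) : 0 ≤ visits p q θ s₀ v T :=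
  Finset.sum_nonneg fun _ _ => ENNReal.toReal_nonneg

theorem ofReal_visits (v : State) (T : ℕ) : ENNReal.ofReal (visits p q θ s₀ v T) =
    ∑ t ∈ Finset.range T, stateLaw p q θ s₀ t v := by
  rw [visits, ENNReal.ofReal_sum_of_nonneg fun _ _ => ENNReal.toReal_nonneg]
  exact Finset.sum_congr rfl fun t _ => ENNReal.ofReal_toReal (PMF.apply_ne_top _ _)

theorem visits_succ_le (v : State) (T : ℕ) :
    visits p q θ s₀ v (T + 1) ≤ visits p q θ s₀ v T + 1 := by
  rw [visits, visits, Finset.sum_range_succ]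
  gcongr
  have := ENNReal.toReal_mono ENNReal.one_ne_top (PMF.coe_le_one (stateLaw p q θ s₀ T) v)
  rwa [ENNReal.toReal_one] at this

theorem mul_visits_le (v u : State) (T : ℕ) :
    visits p q θ s₀ v T * (transition p q v (θ v) u).toReal ≤ visits p q θ s₀ u (T + 1) := by
  rw [visits, visits, Finset.sum_mul, Finset.sum_range_succ']
  refine le_add_of_le_of_nonneg (Finset.sum_le_sum fun t _ => ?_) ENNReal.toReal_nonneg
  rw [← ENNReal.toReal_mul]
  exact ENNReal.toReal_mono (PMF.apply_ne_top _ _) (le_stateLaw_succ p q θ s₀ t v u)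

variable {p q θ s₀} in
theorem Frequent.of_transition {v u : State} (hv : Frequent p q θ s₀ v)
    (hu : transition p q v (θ v) u ≠ 0) : Frequent p q θ s₀ u := by
  intro h
  refine hv ?_
  set c := (transition p q v (θ v) u).toReal with hc
  have hc0 : 0 < c := ENNReal.toReal_pos hu (PMF.apply_ne_top _ _)
  have h2 : Tendsto (fun T : ℕ => (visits p q θ s₀ u T / T + 1 / T) / c) atTop (𝓝 0) := by
    simpa using (h.add tendsto_one_div_atTop_nhds_zero_nat).div_const c
  refine squeeze_zero (fun T => div_nonneg (visits_nonneg ..) (Nat.cast_nonneg T)) (fun T => ?_) h2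
  rw [← add_div, div_div, mul_comm (T : ℝ), ← div_div]
  gcongr
  rw [le_div_iff₀ hc0]
  exact (mul_visits_le p q θ s₀ v u T).trans (visits_succ_le p q θ s₀ u T)

theorem finite_destAge_lt (M : ℕ) : {v : State | v.k + v.d < M}.Finite := by
  refine Set.Finite.of_finite_image (f := fun v : State => (v.k, v.d))
    (((Set.finite_Iio M).prod (Set.finite_Iio M)).subset ?_) ?_
  · rintro _ ⟨v, hv, rfl⟩
    simp only [Set.mem_ofPred_eq] at hv
    simp only [Set.mem_prod, Set.mem_Iio]
    omega
  · intro v _ u _ h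
    simp only [Prod.mk.injEq] at h
    exact State.ext h.1 h.2

/-- Markov's inequality for the destination age. -/
theorem one_le_sum_add_meanAge {S : Finset State} {M : ℕ} (hM : 0 < M)
    (hS : ∀ v : State, v.k + v.d < M → v ∈ S) (t : ℕ) :
    1 ≤ ∑ v ∈ S, (stateLaw p q θ s₀ t v).toReal + meanAge p q θ s₀ t / M := by
  classical
  have hM' : (0 : ℝ) < M := Nat.cast_pos.2 hM
  have h1 : (1 : ℝ≥0∞) ≤ expect (stateLaw p q θ s₀ t) (fun v => (if v ∈ S then 1 else 0) +
      ENNReal.ofReal (1 / M) * destAge v) := by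
    refine (expect_const (stateLaw p q θ s₀ t) 1).symm.le.trans (expect_mono fun v => ?_)
    by_cases hv : v ∈ S
    · simp [hv]
    · have : M ≤ v.k + v.d := not_lt.1 fun h => hv (hS v h)
      have h' : (M : ℝ) ≤ v.k + v.d := by exact_mod_cast this
      rw [if_neg hv, zero_add, destAge_eq, ← ENNReal.ofReal_mul (by positivity),
        ENNReal.one_le_ofReal, div_mul_eq_mul_div, one_mul, one_le_div hM']
      exact h'
  rw [expect_add, expect_const_mul, ← ofReal_meanAge, ← ENNReal.ofReal_mul (by positivity)] at h1
  have h2 : expect (stateLaw p q θ s₀ t) (fun v => if v ∈ S then 1 else 0) =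
      ENNReal.ofReal (∑ v ∈ S, (stateLaw p q θ s₀ t v).toReal) := by
    rw [expect, tsum_eq_sum (s := S) (fun v hv => by simp [hv]),
      ENNReal.ofReal_sum_of_nonneg fun _ _ => ENNReal.toReal_nonneg]
    refine Finset.sum_congr rfl fun v hv => ?_
    rw [ENNReal.ofReal_toReal (PMF.apply_ne_top _ _)]
    simp [hv]
  rw [h2, ← ENNReal.ofReal_add (Finset.sum_nonneg fun _ _ => ENNReal.toReal_nonneg)
    (mul_nonneg (by positivity) (meanAge_nonneg ..)), ENNReal.one_le_ofReal] at h1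
  rwa [one_div_mul_eq_div] at h1

variable {p q θ s₀} in
-- A bounded average age gives tightness: with M > 2G, at least half of the expected time is spent
-- in the finite set of states of age below M, so not all of them can have vanishing frequency.
theorem exists_frequent {G : ℝ}
    (hG : ∀ᶠ T : ℕ in atTop, ∑ t ∈ Finset.range T, meanAge p q θ s₀ t ≤ G * T) :
    ∃ v, Frequent p q θ s₀ v := by
  by_contra! hcon
  simp only [Frequent, not_not] at hcon
  obtain ⟨M, hM⟩ := exists_nat_gt (max (2 * G) 0)
  have hM0 : (0 : ℝ) < M := (le_max_right _ _).trans_lt hM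
  have hMG : 2 * G < M := (le_max_left _ _).trans_lt hM
  let S := (finite_destAge_lt M).toFinset
  have hS : ∀ v : State, v.k + v.d < M → v ∈ S := fun v hv => by simpa [S] using hv
  have hlim : Tendsto (fun T : ℕ => ∑ v ∈ S, visits p q θ s₀ v T / T) atTop (𝓝 0) := by
    simpa using tendsto_finsetSum S fun v _ => hcon v
  obtain ⟨T, hT1, hT2, hT3⟩ := ((hlim.eventually (gt_mem_nhds (by norm_num : (0 : ℝ) < 1 / 2))).and
    (hG.and (eventually_gt_atTop 0))).exists
  have hT : (0 : ℝ) < T := Nat.cast_pos.2 hT3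
  have hsum : (T : ℝ) ≤ ∑ v ∈ S, visits p q θ s₀ v T +
      (∑ t ∈ Finset.range T, meanAge p q θ s₀ t) / M := by
    have := Finset.sum_le_sum fun t (_ : t ∈ Finset.range T) =>
      one_le_sum_add_meanAge p q θ s₀ (Nat.cast_pos.1 hM0) hS t
    rw [Finset.sum_add_distrib, Finset.sum_comm, ← Finset.sum_div] at this
    simpa [visits] using this
  rw [← Finset.sum_div, div_lt_iff₀ hT] at hT1
  have : (∑ t ∈ Finset.range T, meanAge p q θ s₀ t) / M ≤ 1 / 2 * T := by
    rw [div_le_iff₀ hM0]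
    nlinarith
  linarith

end Dynamics

/-- Since A rises by at most one per slot, a large A(T) forces large values throughout the preceding
m slots, so mA(T) ≤ GT + m². Dividing by mT leaves G/m + m/T, which is small for m large and then T
large. -/
theorem tendsto_div_of_sum_le {A : ℕ → ℝ} (h0 : ∀ t, 0 ≤ A t) (h1 : ∀ t, A (t + 1) ≤ A t + 1)
    {G : ℝ} (hG : ∀ᶠ T : ℕ in atTop, ∑ t ∈ Finset.range T, A t ≤ G * T) :
    Tendsto (fun T : ℕ => A T / T) atTop (𝓝 0) := by
  have hstep : ∀ j t, A (t + j) ≤ A t + j := by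
    intro j t
    induction j with
    | zero => simp
    | succ j ih => have := h1 (t + j); rw [← add_assoc]; push_cast; linarith
  have hwin : ∀ m T : ℕ, m ≤ T → m * A T ≤ ∑ t ∈ Finset.range T, A t + m * m := by
    intro m T hmT
    have hsub : ∑ t ∈ Finset.Ico (T - m) T, A t ≤ ∑ t ∈ Finset.range T, A t :=
      Finset.sum_le_sum_of_subset_of_nonneg
        (fun t ht => Finset.mem_range.2 (Finset.mem_Ico.1 ht).2) fun t _ _ => h0 t
    have hlow : ∑ t ∈ Finset.Ico (T - m) T, (A T - m) ≤ ∑ t ∈ Finset.Ico (T - m) T, A t := by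
      refine Finset.sum_le_sum fun t ht => ?_
      have ht := Finset.mem_Ico.1 ht
      have h2 := hstep (T - t) t
      rw [Nat.add_sub_cancel' ht.2.le] at h2
      have : ((T - t : ℕ) : ℝ) ≤ m := by exact_mod_cast (by omega)
      linarith
    rw [Finset.sum_const, Nat.card_Ico, Nat.sub_sub_self hmT, nsmul_eq_mul, mul_sub] at hlow
    linarith
  rw [Metric.tendsto_atTop']
  intro ε hε
  obtain ⟨m, hm⟩ := exists_nat_gt (max (2 * G / ε) 0)
  have hm0 : (0 : ℝ) < m := (le_max_right _ _).trans_lt hm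
  have hmG := (le_max_left _ _).trans_lt hm
  rw [div_lt_iff₀ hε] at hmG
  obtain ⟨N, hN⟩ := eventually_atTop.1 hG
  obtain ⟨N', hN'⟩ := exists_nat_gt (2 * m / ε)
  rw [div_lt_iff₀ hε] at hN'
  refine ⟨max (max N N') m, fun T hT => ?_⟩
  have hTN : N ≤ T := by omega
  have hTN' : N' ≤ T := by omega
  have hTm : m ≤ T := by omega
  have hT0 : (0 : ℝ) < T := hm0.trans_le (by exact_mod_cast hTm)
  rw [dist_zero_right, Real.norm_of_nonneg (div_nonneg (h0 T) hT0.le), div_lt_iff₀ hT0]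
  have e1 := hwin m T hTm
  have e2 := hN T hTN
  have e3 : (N' : ℝ) ≤ T := by exact_mod_cast hTN'
  have e5 := mul_lt_mul_of_pos_right hmG hT0
  have e6 := mul_lt_mul_of_pos_left (hN'.trans_le (mul_le_mul_of_nonneg_right e3 hε.le)) hm0
  have e4 : (m : ℝ) * A T < m * (ε * T) := by linarith
  exact lt_of_mul_lt_mul_left e4 hm0.le

theorem Action.eq_zero_or_one (w : Action) : w = 0 ∨ w = 1 := by
  revert w; decide

theorem Action.le_of_one {w w' : Action} (h : w = 1 → w' = 1) : w ≤ w' := by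
  revert w w'; decide

theorem Action.le_of_zero {w w' : Action} (h : w = 0 → w' = 0) : w' ≤ w := by
  revert w w'; decide

theorem Action.eq_one_of_le {w w' : Action} (h : w ≤ w') (hw : w = 1) : w' = 1 := by
  revert w w'; decide

/-! ### Verification: optimal policies follow the sign of the advantage -/

/-- The Lagrangian cost of one slot. -/
noncomputable def stageCost (lam : ℝ≥0) (θ : Policy) (v : State) : ℝ≥0∞ :=
  destAge v + lam * (((θ v).val : ℕ) : ℝ≥0∞)

theorem totalAge_add_totalForward (p q : unitInterval) (lam : ℝ≥0) (θ : Policy) (s₀ : State)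
    (T : ℕ) : totalAge p q θ s₀ T + (lam : ℝ≥0∞) * totalForward p q θ s₀ T =
      ∑ t ∈ Finset.range T, expect (stateLaw p q θ s₀ t) (stageCost lam θ) := by
  rw [totalAge, totalForward, Finset.mul_sum, ← Finset.sum_add_distrib]
  refine Finset.sum_congr rfl fun t _ => ?_
  rw [← expect_const_mul, ← expect_add]
  rfl

/-- The parameters of the optimality equation of a system. -/
def Params.ofSystem (p q : unitInterval) (hp0 : 0 < p) (hp1 : p < 1) (hq0 : 0 < q) (hq1 : q < 1)
    (lam : ℝ≥0) : Params where
  p := p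
  q := q
  lam := lam
  p_pos := hp0
  p_lt := hp1
  q_pos := hq0
  q_lt := hq1
  lam_nonneg := lam.2

/-- The loss of an action in comparison with the optimal action. -/
noncomputable def loss (P : Params) (h : ℕ → ℕ → ℝ) (v : State) (w : Action) : ℝ :=
  if w = 1 then max (-advantage P 1 h v.k v.d) 0 else max (advantage P 1 h v.k v.d) 0

theorem loss_nonneg (P : Params) (h : ℕ → ℕ → ℝ) (v : State) (w : Action) : 0 ≤ loss P h v w := by
  unfold loss; split_ifs <;> exact le_max_right _ _

section Verification

variable {p q : unitInterval} {hp0 : 0 < p} {hp1 : p < 1} {hq0 : 0 < q} {hq1 : q < 1}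
  {lam : ℝ≥0} {h : ℕ → ℕ → ℝ} {g : ℝ}
  (hh : ∀ k d, 0 ≤ h k d) (hg : 0 ≤ g)
  (hb : ∀ k d, bellman (.ofSystem p q hp0 hp1 hq0 hq1 lam) 1 h k d = h k d + g)
include hh hg hb

/-- The optimality equation as an identity for an arbitrary action, with the suboptimality as
explicit loss. All terms are nonnegative and nothing is subtracted, so it can be summed in `ℝ≥0∞`.
-/
theorem stageCost_add_expect (θ : Policy) (v : State) :
    stageCost lam θ v + expect (transition p q v (θ v)) (fun u => ENNReal.ofReal (h u.k u.d)) =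
      ENNReal.ofReal (h v.k v.d) + (ENNReal.ofReal g +
        ENNReal.ofReal (loss (.ofSystem p q hp0 hp1 hq0 hq1 lam) h v (θ v))) := by
  have hp := p.2.1
  have hq := q.2.1
  have hp' := sub_nonneg.2 p.2.2
  have hq' := sub_nonneg.2 q.2.2
  have hl : (0 : ℝ) ≤ lam := lam.2
  have n1 := hh 1 (v.k + v.d)
  have n2 := hh (v.k + 1) 0
  have n3 := hh (v.k + 1) v.d
  have n4 := hh v.k v.d
  have hb' := hb v.k v.d
  set P : Params := .ofSystem p q hp0 hp1 hq0 hq1 lam with hP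
  have eR : receiveCost P 1 h v.k v.d = p * h 1 (v.k + v.d) + (1 - p) * h (v.k + 1) v.d :=
    one_mul _
  have eF : forwardCost P 1 h v.k v.d =
      lam + (q * h (v.k + 1) 0 + (1 - q) * h (v.k + 1) v.d) := by
    rw [forwardCost, one_mul]; rfl
  have hln := loss_nonneg P h v (θ v)
  rw [← ENNReal.ofReal_add hg hln, ← ENNReal.ofReal_add n4 (add_nonneg hg hln), stageCost,
    destAge_eq]
  obtain hw | hw := Action.eq_zero_or_one (θ v)
  · rw [hw] at hln ⊢
    rw [expect_transition_receive p q hh]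
    simp only [Fin.val_zero, Nat.cast_zero, mul_zero, add_zero]
    rw [← ENNReal.ofReal_add (by positivity) (by positivity)]
    congr 1
    simp only [loss, advantage, if_neg (show (0 : Action) ≠ 1 by decide)]
    rw [bellman] at hb'
    rw [← eR]
    rcases le_total (receiveCost P 1 h v.k v.d) (forwardCost P 1 h v.k v.d) with hle | hle
    · rw [min_eq_left hle] at hb'
      rw [max_eq_right (by linarith)]
      linarith
    · rw [min_eq_right hle] at hb'
      rw [max_eq_left (by linarith)]
      linarith
  · rw [hw] at hln ⊢
    rw [expect_transition_forward p q hh]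
    simp only [Fin.val_one, Nat.cast_one, mul_one]
    rw [← ENNReal.ofReal_coe_nnreal, ← ENNReal.ofReal_add (by positivity) (by positivity),
      ← ENNReal.ofReal_add (by positivity) (by positivity)]
    congr 1
    simp only [loss, advantage, if_true]
    rw [bellman] at hb'
    rw [add_assoc, ← eF]
    rcases le_total (receiveCost P 1 h v.k v.d) (forwardCost P 1 h v.k v.d) with hle | hle
    · rw [min_eq_left hle] at hb'
      rw [max_eq_left (by linarith)]
      linarith
    · rw [min_eq_right hle] at hb'
      rw [max_eq_right (by linarith)]
      linarith

theorem sum_stageCost_add (θ : Policy) (s₀ : State) (T : ℕ) :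
    ∑ t ∈ Finset.range T, expect (stateLaw p q θ s₀ t) (stageCost lam θ) +
      expect (stateLaw p q θ s₀ T) (fun u => ENNReal.ofReal (h u.k u.d)) =
    ENNReal.ofReal (h s₀.k s₀.d) + T * ENNReal.ofReal g +
      ∑ t ∈ Finset.range T, expect (stateLaw p q θ s₀ t)
        (fun v => ENNReal.ofReal (loss (.ofSystem p q hp0 hp1 hq0 hq1 lam) h v (θ v))) := by
  induction T with
  | zero => simp [stateLaw, expect_pure]
  | succ T ih =>
    rw [Finset.sum_range_succ, Finset.sum_range_succ, expect_stateLaw_succ, add_assoc,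
      ← expect_add]
    simp only [stageCost_add_expect hh hg hb]
    rw [expect_add, expect_add, expect_const, ← add_assoc, ih]
    push_cast
    ring

/-- The policy that forwards when the advantage is nonnegative attains the cost `g`. -/
theorem exists_lagrangianCost_le (s₀ : State) :
    ∃ θ : Policy, lagrangianCost p q lam s₀ θ ≤ ENNReal.ofReal g := by
  set P : Params := .ofSystem p q hp0 hp1 hq0 hq1 lam with hP
  let θ : Policy := fun v => if 0 ≤ advantage P 1 h v.k v.d then 1 else 0
  have hloss : ∀ v, loss P h v (θ v) = 0 := by
    intro v
    by_cases hA : 0 ≤ advantage P 1 h v.k v.d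
    · simp [loss, θ, hA]
    · simp [loss, θ, hA, (not_le.1 hA).le]
  refine ⟨θ, ?_⟩
  have hlim : Tendsto (fun T : ℕ => ENNReal.ofReal (h s₀.k s₀.d) * (T : ℝ≥0∞)⁻¹ +
      ENNReal.ofReal g) atTop (𝓝 (ENNReal.ofReal g)) := by
    simpa using (ENNReal.Tendsto.const_mul ENNReal.tendsto_inv_nat_nhds_zero
      (Or.inr ENNReal.ofReal_ne_top)).add_const (ENNReal.ofReal g)
  rw [← hlim.limsup_eq, lagrangianCost]
  refine limsup_le_limsup ?_
  filter_upwards [eventually_gt_atTop 0] with T hT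
  have hT0 : (T : ℝ≥0∞) ≠ 0 := by exact_mod_cast hT.ne'
  rw [totalAge_add_totalForward]
  have := sum_stageCost_add hh hg hb θ s₀ T
  simp only [← hP, hloss, ENNReal.ofReal_zero, expect_const, Finset.sum_const_zero, add_zero] at this
  refine ENNReal.div_le_of_le_mul ((le_self_add.trans this.le).trans (le_of_eq ?_))
  rw [add_mul, mul_assoc, ENNReal.inv_mul_cancel hT0 (ENNReal.natCast_ne_top T), mul_one,
    mul_comm (T : ℝ≥0∞)]

variable {C : ℝ} (hC : ∀ k d : ℕ, h k d ≤ C * (k + d)) {θ : Policy} {s₀ : State}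
  (hθ : IsLagrangianOptimal p q lam s₀ θ)
include hθ

theorem eventually_sum_stageCost_le {η : ℝ} (hη : 0 < η) : ∀ᶠ T : ℕ in atTop,
    ∑ t ∈ Finset.range T, expect (stateLaw p q θ s₀ t) (stageCost lam θ) ≤
      ENNReal.ofReal ((g + η) * T) := by
  obtain ⟨θ', hθ'⟩ := exists_lagrangianCost_le hh hg hb s₀
  have hlt : lagrangianCost p q lam s₀ θ < ENNReal.ofReal (g + η) :=
    ((hθ θ').trans hθ').trans_lt ((ENNReal.ofReal_lt_ofReal_iff (by linarith)).2 (by linarith))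
  filter_upwards [eventually_lt_of_limsup_lt hlt, eventually_gt_atTop 0] with T h1 hT
  rw [totalAge_add_totalForward] at h1
  rw [ENNReal.ofReal_mul (by linarith), ENNReal.ofReal_natCast]
  exact (ENNReal.div_le_iff (by exact_mod_cast hT.ne') (ENNReal.natCast_ne_top T)).1 h1.le

theorem eventually_sum_meanAge_le : ∀ᶠ T : ℕ in atTop,
    ∑ t ∈ Finset.range T, meanAge p q θ s₀ t ≤ (g + 1) * T := by
  filter_upwards [eventually_sum_stageCost_le hh hg hb hθ one_pos] with T hT
  rw [← ENNReal.ofReal_le_ofReal_iff (by positivity),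
    ENNReal.ofReal_sum_of_nonneg fun _ _ => meanAge_nonneg ..]
  refine le_trans (Finset.sum_le_sum fun t _ => ?_) hT
  rw [ofReal_meanAge]
  exact expect_mono fun v => le_self_add

include hC

theorem loss_eq_zero_of_frequent {v : State} (hv : Frequent p q θ s₀ v) :
    loss (.ofSystem p q hp0 hp1 hq0 hq1 lam) h v (θ v) = 0 := by
  set P : Params := .ofSystem p q hp0 hp1 hq0 hq1 lam with hP
  by_contra hne
  set δ := loss P h v (θ v) with hδ
  have hδ0 : 0 < δ := (loss_nonneg ..).lt_of_ne' hne
  have hC0 : 0 ≤ C := by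
    have := (hh 1 0).trans (hC 1 0)
    simpa using this
  have hA := tendsto_div_of_sum_le (meanAge_nonneg p q θ s₀) (meanAge_succ_le p q θ s₀)
    (eventually_sum_meanAge_le hh hg hb hθ)
  -- Keep only the losses incurred at v in the telescoped identity, and compare with the optimal
  -- cost (g + η)T. The terminal term is at most C times the mean age, which is o(T) by `hA`.
  have key : ∀ η : ℝ, 0 < η → ∀ᶠ T : ℕ in atTop,
      δ * visits p q θ s₀ v T ≤ η * T + C * meanAge p q θ s₀ T := by
    intro η hη
    filter_upwards [eventually_sum_stageCost_le hh hg hb hθ hη] with T hT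
    have hN := visits_nonneg p q θ s₀ v T
    have hm := meanAge_nonneg p q θ s₀ T
    have e1 : ENNReal.ofReal (T * g + δ * visits p q θ s₀ v T) ≤
        ENNReal.ofReal ((g + η) * T + C * meanAge p q θ s₀ T) := by
      rw [ENNReal.ofReal_add (by positivity) (by positivity),
        ENNReal.ofReal_add (by positivity) (by positivity),
        ENNReal.ofReal_mul (Nat.cast_nonneg T), ENNReal.ofReal_natCast]
      calc (T : ℝ≥0∞) * ENNReal.ofReal g + ENNReal.ofReal (δ * visits p q θ s₀ v T)
          ≤ T * ENNReal.ofReal g + ∑ t ∈ Finset.range T, expect (stateLaw p q θ s₀ t)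
              (fun v => ENNReal.ofReal (loss P h v (θ v))) := by
            rw [ENNReal.ofReal_mul hδ0.le, ofReal_visits, Finset.mul_sum]
            gcongr with t _
            rw [mul_comm]
            exact mul_le_expect (stateLaw p q θ s₀ t)
              (fun v => ENNReal.ofReal (loss P h v (θ v))) v
        _ ≤ ENNReal.ofReal (h s₀.k s₀.d) + T * ENNReal.ofReal g +
              ∑ t ∈ Finset.range T, expect (stateLaw p q θ s₀ t)
              (fun v => ENNReal.ofReal (loss P h v (θ v))) := by
            rw [add_assoc]; exact le_add_self
        _ = _ := (sum_stageCost_add hh hg hb θ s₀ T).symm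
        _ ≤ _ := by
            refine add_le_add hT ?_
            rw [ENNReal.ofReal_mul hC0, ofReal_meanAge, ← expect_const_mul]
            refine expect_mono fun u => ?_
            rw [destAge_eq, ← ENNReal.ofReal_mul hC0]
            exact ENNReal.ofReal_le_ofReal (hC u.k u.d)
    have e2 := (ENNReal.ofReal_le_ofReal_iff (by positivity)).1 e1
    linarith
  refine hv ?_
  rw [Metric.tendsto_atTop']
  intro ε hε
  have hev := (hA.const_mul C).eventually (gt_mem_nhds
    (show C * 0 < δ * ε / 2 by rw [mul_zero]; positivity))
  obtain ⟨N, hN⟩ := eventually_atTop.1 ((key (δ * ε / 2) (by positivity)).and hev)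
  refine ⟨N, fun T hT => ?_⟩
  obtain ⟨h1, h2⟩ := hN T hT.le
  have hT0 : (0 : ℝ) < T := Nat.cast_pos.2 (by omega)
  rw [dist_zero_right, Real.norm_of_nonneg (div_nonneg (visits_nonneg ..) hT0.le),
    div_lt_iff₀ hT0]
  rw [← mul_div_assoc, div_lt_iff₀ hT0] at h2
  refine lt_of_mul_lt_mul_left ?_ hδ0.le
  linarith

theorem advantage_sign_of_frequent {v : State} (hv : Frequent p q θ s₀ v) :
    (θ v = 1 → 0 ≤ advantage (.ofSystem p q hp0 hp1 hq0 hq1 lam) 1 h v.k v.d) ∧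
    (θ v = 0 → advantage (.ofSystem p q hp0 hp1 hq0 hq1 lam) 1 h v.k v.d ≤ 0) := by
  have h0 := loss_eq_zero_of_frequent hh hg hb hC hθ hv
  constructor <;> intro hw <;>
    simp only [loss, hw, if_true, if_neg (show (0 : Action) ≠ 1 by decide)] at h0
  · linarith [le_max_left (-advantage (.ofSystem p q hp0 hp1 hq0 hq1 lam) 1 h v.k v.d) 0]
  · linarith [le_max_left (advantage (.ofSystem p q hp0 hp1 hq0 hq1 lam) 1 h v.k v.d) 0]

/-- Under an optimal policy every state is visited with non-vanishing frequency. -/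
theorem frequent_of_optimal (hs : Structured (.ofSystem p q hp0 hp1 hq0 hq1 lam) h) (v : State) :
    Frequent p q θ s₀ v := by
  set P : Params := .ofSystem p q hp0 hp1 hq0 hq1 lam with hP
  have hsign := fun {v} => advantage_sign_of_frequent hh hg hb hC hθ (v := v)
  have next : ∀ {v : State}, Frequent p q θ s₀ v → ∀ b b' (u : State),
      u.k = nextAge v (θ v) b → u.d = nextGain v (θ v) b b' → Frequent p q θ s₀ u := by
    intro v hv b b' u hk hd
    have hu : u = nextState v (θ v) b b' := State.ext hk hd
    rw [hu]
    exact hv.of_transition (transition_nextState_ne_zero hp0 hp1 hq0 hq1 v (θ v) b b')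
  -- When both links fail the relay age grows and the gain stays, whatever the action, so no
  -- knowledge of θ is needed.
  have older : ∀ (j : ℕ) {v : State}, Frequent p q θ s₀ v → ∀ u : State, u.k = v.k + j →
      u.d = v.d → Frequent p q θ s₀ u := by
    intro j
    induction j with
    | zero => intro v hv u hk hd; rwa [show u = v from State.ext hk hd]
    | succ j ih =>
      intro v hv u hk hd
      have hadm := v.admissible
      let w : State := ⟨v.k + j, v.d, by unfold Admissible at *; omega⟩
      refine next (ih hv w rfl rfl) false false u ?_ ?_
      · simp [nextAge, w, hk]; ring
      · simp [nextGain, w, hd]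
  obtain ⟨v₀, hv₀⟩ := exists_frequent (eventually_sum_meanAge_le hh hg hb hθ)
  obtain ⟨K, hK⟩ := exists_advantage_neg hs hb v₀.d
  obtain ⟨M, hM⟩ := exists_advantage_pos hs hb 1
  have receive : ∀ {v : State}, Frequent p q θ s₀ v → advantage P 1 h v.k v.d < 0 →
      ∀ u : State, u.k = 1 → u.d = v.k + v.d → Frequent p q θ s₀ u := by
    intro v hv hneg u hk hd
    have hw : θ v = 0 := by
      by_contra hw
      have := (hsign hv).1 ((Action.eq_zero_or_one _).resolve_left hw)
      linarith
    refine next hv true true u ?_ ?_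
    · simp [nextAge, hw, hk]
    · simp [nextGain, hw, hd]
  have hadm₀ := v₀.admissible
  -- K makes the advantage negative, forcing reception; M makes the resulting gain large enough to
  -- force forwarding at relay age 1; 2 makes that gain admissible.
  let v₁ : State := ⟨v₀.k + (K + M + 2), v₀.d, by unfold Admissible at *; omega⟩
  let v₂ : State := ⟨1, v₁.k + v₁.d, by simp [Admissible, v₁]; omega⟩
  let v₃ : State := ⟨2, 0, by simp [Admissible]⟩
  have hv₁ : Frequent p q θ s₀ v₁ := older _ hv₀ v₁ rfl rfl
  have hv₂ : Frequent p q θ s₀ v₂ := receive hv₁ (hK _ (by simp only [v₁]; omega)) v₂ rfl rfl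
  have hv₃ : Frequent p q θ s₀ v₃ := by
    have hpos : 0 < advantage P 1 h v₂.k v₂.d := hM _ (by simp only [v₂, v₁]; omega)
    have hw : θ v₂ = 1 := by
      by_contra hw
      have := (hsign hv₂).2 ((Action.eq_zero_or_one _).resolve_right hw)
      linarith
    refine next hv₂ true true v₃ ?_ ?_
    · simp [nextAge, hw, v₂, v₃]
    · simp [nextGain, hw, v₃]
  have hzero : ∀ u : State, u.d = 0 → Frequent p q θ s₀ u := by
    intro u hd
    have hadm := u.admissible
    refine older (u.k - 2) hv₃ u ?_ hd
    simp only [v₃]; unfold Admissible at hadm; omega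
  rcases v.admissible with hadm | hadm
  · exact hzero v hadm.2
  -- Reception is forced at (d, 0) and its success gives (1, d), from which ageing reaches (k, d).
  · let u : State := ⟨v.d, 0, by simp [Admissible]; omega⟩
    have hu := receive (hzero u rfl) (advantage_zero_neg hs hb hadm.2) ⟨1, v.d, by
      simp [Admissible]; omega⟩ rfl rfl
    refine older (v.k - 1) hu v ?_ rfl
    simp only; omega

end Verification

/-! ### From switching type to thresholds -/

theorem IsSwitchingType.isMonotonePolicy {θ : Policy} (h : IsSwitchingType θ) :
    IsMonotonePolicy θ := by
  constructor
  · rintro ⟨k, d, hv⟩ ⟨k', d', hv'⟩ hk hd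
    obtain rfl : k = k' := hk
    obtain ⟨z, rfl⟩ := Nat.exists_eq_add_of_le hd
    exact Action.le_of_one (h.1 k d z hv hv')
  · rintro ⟨k, d, hv⟩ ⟨k', d', hv'⟩ hd hk
    obtain rfl : d = d' := hd
    obtain ⟨z, rfl⟩ := Nat.exists_eq_add_of_le hk
    exact Action.le_of_zero (h.2 k d z hv hv')

theorem IsMonotonePolicy.isMultiThreshold {θ : Policy} (h : IsMonotonePolicy θ) :
    IsMultiThreshold θ := by
  constructor
  · refine ⟨fun k => ⨅ (v : State) (_ : v.k = k ∧ θ v = 1), (v.d : ℕ∞), fun v => ⟨fun hv =>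
      iInf₂_le v ⟨rfl, hv⟩, fun hv => ?_⟩⟩
    by_contra hne
    have hle : ((v.d + 1 : ℕ) : ℕ∞) ≤ v.d := by
      refine le_trans (le_iInf₂ fun u hu => ?_) hv
      by_contra hlt
      have hd : u.d ≤ v.d := by
        have : u.d < v.d + 1 := by exact_mod_cast not_le.1 hlt
        omega
      exact hne (Action.eq_one_of_le (h.1 u v hu.1 hd) hu.2)
    have : v.d + 1 ≤ v.d := by exact_mod_cast hle
    omega
  · refine ⟨fun d => ⨆ (v : State) (_ : v.d = d ∧ θ v = 1), (v.k : ℕ∞), fun v => ⟨fun hv =>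
      le_iSup₂_of_le v ⟨rfl, hv⟩ le_rfl, fun hv => ?_⟩⟩
    by_contra hne
    -- Positivity of the relay age makes the predecessor a genuine decrease; it also handles the
    -- empty supremum, which is 0.
    have hk : 1 ≤ v.k := by have := v.admissible; unfold Admissible at this; omega
    have hle : (v.k : ℕ∞) ≤ ((v.k - 1 : ℕ) : ℕ∞) := by
      refine hv.trans (iSup₂_le fun u hu => ?_)
      by_contra hlt
      have hk : v.k ≤ u.k := by
        have : v.k - 1 < u.k := by exact_mod_cast not_le.1 hlt
        omega
      exact hne (Action.eq_one_of_le (h.2 v u hu.1.symm hk) hu.2)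
    have : v.k ≤ v.k - 1 := by exact_mod_cast hle
    omega

/-- A policy that follows the sign of the advantage is of switching type, however it breaks
ties. -/
theorem isSwitchingType_of_advantage_sign {P : Params} {h : ℕ → ℕ → ℝ} {g : ℝ}
    (hs : Structured P h) (hb : ∀ k d, bellman P 1 h k d = h k d + g) {θ : Policy}
    (hsign : ∀ v : State, (θ v = 1 → 0 ≤ advantage P 1 h v.k v.d) ∧
      (θ v = 0 → advantage P 1 h v.k v.d ≤ 0)) : IsSwitchingType θ := by
  constructor
  · intro k d z hv hv' hw
    rcases Nat.eq_zero_or_pos z with rfl | hz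
    · exact hw
    by_contra hne
    have h1 := (hsign _).1 hw
    have h2 := (hsign ⟨k, d + z, hv'⟩).2 ((Action.eq_zero_or_one _).resolve_right hne)
    have h3 := advantage_strictMono hs hb k (show d < d + z by omega)
    linarith
  · intro k d z hv hv' hw
    rcases Nat.eq_zero_or_pos z with rfl | hz
    · exact hw
    by_contra hne
    have h1 := (hsign _).2 hw
    have h2 := (hsign ⟨k + z, d, hv'⟩).1 ((Action.eq_zero_or_one _).resolve_left hne)
    -- Nonnegativity is carried back from k + z to k + 1, where the strict decrease to k + 1 from k
    -- becomes available.
    have h3 : advantage P 1 h (k + z) d ≤ advantage P 1 h (k + 1) d :=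
      antitone_nat_of_succ_le (f := fun k => advantage P 1 h k d)
        (fun k => hs.advantage_anti_k zero_le_one k d) (by omega)
    have h4 := advantage_succ_add_le hs hb (k := k) (d := d) (h2.trans h3)
    have h5 : 0 < P.p * (min P.p P.q * P.q) :=
      mul_pos P.p_pos (mul_pos (lt_min P.p_pos P.q_pos) P.q_pos)
    linarith [h2.trans h3]

end RelayAoI

theorem theorem2 (p q : unitInterval) (hp0 : 0 < p) (hp1 : p < 1) (hq0 : 0 < q) (hq1 : q < 1)
    (lam : ℝ≥0) (s₀ : RelayAoI.State) (θ : RelayAoI.Policy)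
    (hθ : RelayAoI.IsLagrangianOptimal p q lam s₀ θ) :
    RelayAoI.IsSwitchingType θ ∧ RelayAoI.IsMonotonePolicy θ ∧ RelayAoI.IsMultiThreshold θ := by
  obtain ⟨h, g, hs, hb, hh, hg⟩ :=
    RelayAoI.exists_average_solution (.ofSystem p q hp0 hp1 hq0 hq1 lam)
  have hsw : RelayAoI.IsSwitchingType θ := RelayAoI.isSwitchingType_of_advantage_sign hs hb
    fun v => RelayAoI.advantage_sign_of_frequent (fun k d => (hh k d).1) hg hb
      (fun k d => (hh k d).2) hθ (RelayAoI.frequent_of_optimal (fun k d => (hh k d).1) hg hb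
        (fun k d => (hh k d).2) hθ hs v)
  exact ⟨hsw, hsw.isMonotonePolicy, hsw.isMonotonePolicy.isMultiThreshold⟩
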